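/- Let $g_1, g_2, \dots$ be an exchangeable sequence of real-valued random variables on a probability space $(\Omega, \mathcal F, \mathbb P)$ (for every $n$, the law of $(g_1,\dots,g_n)$ is invariant under permutations of the indices), and let $\mathcal T_* = \bigcap_{n} \sigma(g_n, g_{n+1}, \dots)$ be its tail $\sigma$-algebra. For $\varepsilon > 0$ and $t > 0$ put $$\Delta_t(\varepsilon) = \mathbb E\big(g_1 \mathbf 1_{\{|g_1| \le \varepsilon t\}} \,\big|\, \mathcal T_*\big), \qquad T_t(\varepsilon) = t\, \mathbb P\big(|g_1| > \varepsilon t \,\big|\, \mathcal T_*\big), \qquad \Sigma_t(\varepsilon) = \tfrac1t\, \mathbb E\big(g_1^2 \mathbf 1_{\{|g_1| \le \varepsilon t\}} \,\big|\, \mathcal T_*\big),$$ $$V_t(\varepsilon) = \tfrac1t\, \mathrm{Var}\big(g_1 \mathbf 1_{\{|g_1| \le \varepsilon t\}} \,\big|\, \mathcal T_*\big), \qquad R_t(\varepsilon) = \tfrac1t\, \mathbb E\big((|g_1| \wedge \varepsilon t)^2 \,\big|\, \mathcal T_*\big),$$ all computed from one regular conditional distribution of $g_1$ given $\mathcal T_*$.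 Then the following are equivalent. * (i) There exist real-valued, $\mathcal T_*$-measurable $D_1, D_2, \dots$ such that for every $\varepsilon > 0$, $\ \mathbb P\big(\big|\frac1N \sum_{n=1}^N g_n - D_N\big| > \varepsilon\big) \to 0$ as $N \to \infty$. * (i)$'$ There exist real-valued, $\mathcal T_*$-measurable $D_1, D_2, \dots$ such that for every $\varepsilon > 0$, $\ \mathbb P\big(\big|\frac1N \sum_{n=1}^N g_n - D_N\big| > \varepsilon \,\big|\, \mathcal T_*\big) \to 0$ in probability as $N \to \infty$. * (ii) For every $\varepsilon > 0$, both $T_t(\varepsilon) \to 0$ and $\Sigma_t(\varepsilon) \to 0$ in probability as $t \to \infty$. * (ii)$'$ For every $\varepsilon > 0$, both $T_t(\varepsilon) \to 0$ and $V_t(\varepsilon) \to 0$ in probability as $t \to \infty$. * (ii)$''$ For every $\varepsilon > 0$, $R_t(\varepsilon) \to 0$ in probability as $t \to \infty$. * (iii) For every $\varepsilon > 0$, $\frac1M \int_0^M T_t(\varepsilon)\, dt \to 0$ in probability as $M \to \infty$. * (iii)$'$ For every $\varepsilon > 0$, $M \int_M^\infty \Sigma_t(\varepsilon)\, t^{-2}\,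 dt \to 0$ in probability as $M \to \infty$. * (iii)$''$ For every $\varepsilon > 0$, $M \int_M^\infty V_t(\varepsilon)\, t^{-2}\, dt \to 0$ in probability as $M \to \infty$. When these equivalent conditions hold, the convergences in (i) and (i)$'$ both hold with $D_N = \Delta_N(1) = \mathbb E(g_1 \mathbf 1_{\{|g_1| \le N\}} \mid \mathcal T_*)$. Moreover, any sequence $(D_N)$ as in (i) or (i)$'$ satisfies $D_N / \sqrt N \to 0$ in probability. -/

import Mathlib

open MeasureTheory ProbabilityTheory Filter Topology

namespace ExchWLLN

noncomputable section

variable {Ω : Type*} [mΩ : MeasurableSpace Ω]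

/-- A sequence `g 0, g 1, …` of real random variables is exchangeable if, for every `n` and every
permutation `π` of the first `n` indices, the vectors `(g (π 0), …, g (π (n - 1)))` and
`(g 0, …, g (n - 1))` have the same law. -/
def Exchangeable (μ : Measure Ω) (g : ℕ → Ω → ℝ) : Prop :=
  ∀ (n : ℕ) (π : Equiv.Perm (Fin n)),
    μ.map (fun ω (i : Fin n) => g (π i) ω) = μ.map (fun ω (i : Fin n) => g i ω)

/-- The tail σ-algebra `⋂ n, σ(g n, g (n + 1), …)`. -/
@[reducible] def tail (g : ℕ → Ω → ℝ) : MeasurableSpace Ω :=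
  ⨅ n : ℕ, ⨆ k : ℕ, ⨆ _ : n ≤ k, MeasurableSpace.comap (g k) inferInstance

/-- The average of the first `N` terms of the sequence. -/
def avg (g : ℕ → Ω → ℝ) (N : ℕ) (ω : Ω) : ℝ :=
  (1 / (N : ℝ)) * ∑ n ∈ Finset.range N, g n ω

/-- The regular conditional distribution of the first term of the sequence given the tail
σ-algebra: a Markov kernel from `(Ω, tail g)` to `ℝ`. All the tail-conditional quantities below are
taken with respect to this kernel, which fixes, simultaneously for all truncation levels, versions
of the conditional expectations that are jointly measurable in the truncation level and `ω`. The
lemmas at the end of the file identify them with the conditional expectations they stand for. -/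
def tailLaw (μ : Measure Ω) [IsFiniteMeasure μ] (g : ℕ → Ω → ℝ) : @Kernel Ω ℝ (tail g) _ :=
  @condDistrib Ω Ω ℝ _ _ _ mΩ (tail g) (g 0) id μ _

/-- The truncation `x ↦ x 1_{|x| ≤ c}`. -/
def trunc (c x : ℝ) : ℝ := Set.indicator {y : ℝ | |y| ≤ c} (fun y => y) x

/-- `Δ_t(ε) = E(g₁ 1_{|g₁| ≤ ε t} | tail)`. -/
def condMean (μ : Measure Ω) [IsFiniteMeasure μ] (g : ℕ → Ω → ℝ) (ε t : ℝ) (ω : Ω) : ℝ :=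
  ∫ x, trunc (ε * t) x ∂(tailLaw μ g ω)

/-- `T_t(ε) = t P(|g₁| > ε t | tail)`. -/
def condTail (μ : Measure Ω) [IsFiniteMeasure μ] (g : ℕ → Ω → ℝ) (ε t : ℝ) (ω : Ω) : ℝ :=
  t * (tailLaw μ g ω).real {x : ℝ | ε * t < |x|}

/-- `Σ_t(ε) = (1/t) E(g₁² 1_{|g₁| ≤ ε t} | tail)`. -/
def condSecond (μ : Measure Ω) [IsFiniteMeasure μ] (g : ℕ → Ω → ℝ) (ε t : ℝ) (ω : Ω) : ℝ :=
  (1 / t) * ∫ x, Set.indicator {y : ℝ | |y| ≤ ε * t} (fun y => y ^ 2) x ∂(tailLaw μ g ω)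

/-- `V_t(ε) = (1/t) Var(g₁ 1_{|g₁| ≤ ε t} | tail)`. -/
def condVariance (μ : Measure Ω) [IsFiniteMeasure μ] (g : ℕ → Ω → ℝ) (ε t : ℝ) (ω : Ω) : ℝ :=
  (1 / t) * variance (trunc (ε * t)) (tailLaw μ g ω)

/-- `R_t(ε) = (1/t) E((|g₁| ∧ ε t)² | tail)`. -/
def condTruncSecond (μ : Measure Ω) [IsFiniteMeasure μ] (g : ℕ → Ω → ℝ) (ε t : ℝ) (ω : Ω) : ℝ :=
  (1 / t) * ∫ x, (min |x| (ε * t)) ^ 2 ∂(tailLaw μ g ω)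

/-- `D` is a sequence of tail-measurable correctors for which the weak law of large numbers
holds. -/
def WLLN (μ : Measure Ω) (g D : ℕ → Ω → ℝ) : Prop :=
  (∀ N, Measurable[tail g] (D N)) ∧
    ∀ ε : ℝ, 0 < ε → Tendsto (fun N : ℕ => μ.real {ω | ε < |avg g N ω - D N ω|}) atTop (𝓝 0)

/-- `D` is a sequence of tail-measurable correctors for which the conditional weak law of large
numbers holds: the conditional probabilities of deviation, given the tail σ-algebra, tend to zero
in probability. -/
def CondWLLN (μ : Measure Ω) (g D : ℕ → Ω → ℝ) : Prop :=
  (∀ N, Measurable[tail g] (D N)) ∧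
    ∀ ε : ℝ, 0 < ε → TendstoInMeasure μ
      (fun N : ℕ => μ⟦{ω | ε < |avg g N ω - D N ω|} | tail g⟧) atTop (fun _ => (0 : ℝ))

/-! The quantities above are versions of the conditional expectations that they stand for. -/

lemma tail_le {g : ℕ → Ω → ℝ} (hg : ∀ n, Measurable (g n)) : tail g ≤ mΩ := by
  refine (iInf_le _ 0).trans (iSup_le fun k => iSup_le fun _ => (hg k).comap_le)

lemma condExp_ae_eq_tailLaw (μ : Measure Ω) [IsFiniteMeasure μ] {g : ℕ → Ω → ℝ}
    (hg : ∀ n, Measurable (g n)) {f : ℝ → ℝ} (hf : Measurable f)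
    (hint : Integrable (fun ω => f (g 0 ω)) μ) :
    μ[fun ω => f (g 0 ω) | tail g] =ᵐ[μ] fun ω => ∫ x, f x ∂(tailLaw μ g ω) := by
  have h := @condExp_ae_eq_integral_condDistrib Ω Ω ℝ ℝ _ _ _ _ mΩ μ _ id (g 0) (tail g) _ _
    (measurable_id'' (tail_le hg)) (hg 0).aemeasurable f hf.stronglyMeasurable hint
  rwa [MeasurableSpace.comap_id] at h

lemma measurable_trunc (c : ℝ) : Measurable (trunc c) :=
  measurable_id.indicator (measurableSet_le measurable_norm measurable_const)

lemma abs_trunc_le (c x : ℝ) : |trunc c x| ≤ |c| := by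
  by_cases h : |x| ≤ c
  · simpa [trunc, Set.indicator, h] using h.trans (le_abs_self c)
  · simp [trunc, Set.indicator, h]

lemma memLp_trunc (μ : Measure Ω) [IsFiniteMeasure μ] {X : Ω → ℝ} (hX : Measurable X) (c : ℝ)
    (p : ENNReal) : MemLp (fun ω => trunc c (X ω)) p μ :=
  MemLp.of_bound ((measurable_trunc c).comp hX).aestronglyMeasurable |c|
    (Eventually.of_forall fun ω => by simpa using abs_trunc_le c (X ω))

lemma condMean_ae_eq (μ : Measure Ω) [IsFiniteMeasure μ] {g : ℕ → Ω → ℝ}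
    (hg : ∀ n, Measurable (g n)) (ε t : ℝ) :
    condMean μ g ε t =ᵐ[μ] μ[fun ω => trunc (ε * t) (g 0 ω) | tail g] :=
  (condExp_ae_eq_tailLaw μ hg (measurable_trunc _)
    ((memLp_trunc μ (hg 0) _ 1).integrable le_rfl)).symm

lemma condTail_ae_eq (μ : Measure Ω) [IsFiniteMeasure μ] {g : ℕ → Ω → ℝ}
    (hg : ∀ n, Measurable (g n)) (ε t : ℝ) :
    condTail μ g ε t =ᵐ[μ] fun ω => t * (μ⟦{ω | ε * t < |g 0 ω|} | tail g⟧) ω := by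
  have hs : MeasurableSet {x : ℝ | ε * t < |x|} :=
    measurableSet_lt measurable_const measurable_norm
  have h := condExp_ae_eq_tailLaw μ hg (f := {x : ℝ | ε * t < |x|}.indicator fun _ => 1)
    (measurable_const.indicator hs)
    (Integrable.indicator (s := {ω | ε * t < |g 0 ω|}) (integrable_const (1 : ℝ)) ((hg 0) hs))
  filter_upwards [h] with ω hω
  rw [integral_indicator_const _ hs, smul_eq_mul, mul_one] at hω
  rw [condTail, ← hω]
  rfl

lemma condSecond_ae_eq (μ : Measure Ω) [IsFiniteMeasure μ] {g : ℕ → Ω → ℝ}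
    (hg : ∀ n, Measurable (g n)) (ε t : ℝ) :
    condSecond μ g ε t =ᵐ[μ] fun ω => (1 / t) *
      (μ[{ω | |g 0 ω| ≤ ε * t}.indicator (fun ω => g 0 ω ^ 2) | tail g]) ω := by
  have hs : MeasurableSet {x : ℝ | |x| ≤ ε * t} :=
    measurableSet_le measurable_norm measurable_const
  have e : (fun ω => trunc (ε * t) (g 0 ω) ^ 2) =
      fun ω => {y : ℝ | |y| ≤ ε * t}.indicator (fun y => y ^ 2) (g 0 ω) := by
    funext ω
    by_cases h : |g 0 ω| ≤ ε * t <;> simp [trunc, Set.indicator, h]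
  have hi := (memLp_trunc μ (hg 0) (ε * t) 2).integrable_sq
  rw [e] at hi
  filter_upwards [condExp_ae_eq_tailLaw μ hg ((measurable_id.pow_const 2).indicator hs) hi]
    with ω hω
  rw [condSecond]
  exact congrArg _ hω.symm

lemma condVariance_ae_eq (μ : Measure Ω) [IsFiniteMeasure μ] {g : ℕ → Ω → ℝ}
    (hg : ∀ n, Measurable (g n)) (ε t : ℝ) :
    condVariance μ g ε t =ᵐ[μ] fun ω => (1 / t) *
      (Var[fun ω => trunc (ε * t) (g 0 ω); μ | tail g]) ω := by
  have h2 := memLp_trunc μ (hg 0) (ε * t) 2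
  filter_upwards [condVar_ae_eq_condExp_sq_sub_sq_condExp (tail_le hg) h2,
    condMean_ae_eq μ hg ε t,
    condExp_ae_eq_tailLaw μ hg ((measurable_trunc (ε * t)).pow_const 2) h2.integrable_sq]
    with ω h3 h4 h5
  have hK : IsProbabilityMeasure (tailLaw μ g ω) := by unfold tailLaw; infer_instance
  have hL : MemLp (trunc (ε * t)) 2 (tailLaw μ g ω) := memLp_trunc _ measurable_id (ε * t) 2
  rw [condVariance, variance_eq_sub hL, h3]
  congr 1
  change _ = (μ[fun ω => trunc (ε * t) (g 0 ω) ^ 2 | tail g]) ω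
    - (μ[fun ω => trunc (ε * t) (g 0 ω) | tail g]) ω ^ 2
  rw [h5, ← h4]
  rfl

lemma condTruncSecond_ae_eq (μ : Measure Ω) [IsFiniteMeasure μ] {g : ℕ → Ω → ℝ}
    (hg : ∀ n, Measurable (g n)) (ε t : ℝ) (hε : 0 < ε) (ht : 0 < t) :
    condTruncSecond μ g ε t =ᵐ[μ] fun ω => (1 / t) *
      (μ[fun ω => (min |g 0 ω| (ε * t)) ^ 2 | tail g]) ω := by
  have hm : Measurable fun x : ℝ => (min |x| (ε * t)) ^ 2 := by fun_prop
  have hi : Integrable (fun ω => (min |g 0 ω| (ε * t)) ^ 2) μ := by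
    refine Integrable.of_bound (hm.comp (hg 0)).aestronglyMeasurable ((ε * t) ^ 2)
      (Eventually.of_forall fun ω => ?_)
    have : 0 ≤ min |g 0 ω| (ε * t) := le_min (abs_nonneg _) (mul_pos hε ht).le
    rw [Real.norm_eq_abs, abs_of_nonneg (by positivity)]
    gcongr
    exact min_le_right _ _
  filter_upwards [condExp_ae_eq_tailLaw μ hg hm hi] with ω hω
  rw [condTruncSecond, ← hω]

end

end ExchWLLN

/-
By de Finetti's theorem the `g n` are, conditionally on the tail, independent with common law
`ν = tailLaw μ g ω`, so everything reduces to the weak law for i.i.d. variables, uniformly in `ν`.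

If `R_N(1)` is small, truncating at level `N` changes the average with small probability, and
Chebyshev's inequality controls the truncated average around `Δ_N(1)`. Conversely, concentration of
the average around some number forces `|charFun ν u| ^ N` to be close to `1` for `|u| ≤ 1 / N`;
hence the symmetrized law has a small capped second moment at level `N`, and undoing the
symmetrization costs a constant factor and an error `K² / N`, where `ν` gives mass at least `3 / 4`
to `[-K, K]`. The same mass condition compares variances with second moments. By Fubini's theorem
the averages in (iii) and (iii)' are constant multiples of `R_M(ε)`.
-/

namespace ExchWLLN

open scoped ENNReal

/-! ### De Finetti's theorem for the tail -/

section Iid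

variable {ι : Type*} {E : ι → Type*} [∀ i, MeasurableSpace (E i)]

lemma isPiSystem_measurable_squareCylinders :
    IsPiSystem (squareCylinders fun i => {s : Set (E i) | MeasurableSet s}) :=
  isPiSystem_squareCylinders (fun _ => MeasurableSpace.isPiSystem_measurableSet)
    fun _ => MeasurableSet.univ

lemma ext_of_finset_pi {μ ν : Measure (∀ i, E i)} [IsFiniteMeasure μ]
    (h : ∀ (s : Finset ι) (t : ∀ i, Set (E i)), (∀ i, MeasurableSet (t i)) →
      μ ((s : Set ι).pi t) = ν ((s : Set ι).pi t)) : μ = ν := by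
  refine ext_of_generate_finite _ generateFrom_squareCylinders.symm
    isPiSystem_measurable_squareCylinders ?_ (by simpa using h ∅ fun _ => Set.univ)
  rintro _ ⟨s, t, ht, rfl⟩
  exact h s t fun i => ht i trivial

/-- The kernel that sends `a` to the law of an i.i.d. sequence with common law `κ a`. -/
noncomputable def iidKernel {α : Type*} [MeasurableSpace α] (κ : Kernel α ℝ) [IsMarkovKernel κ] :
    Kernel α (ℕ → ℝ) where
  toFun a := Measure.infinitePi fun _ => κ a
  measurable' := by
    refine .measure_of_isPiSystem_of_isProbabilityMeasure generateFrom_squareCylinders.symm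
      isPiSystem_measurable_squareCylinders ?_
    rintro _ ⟨s, t, ht, rfl⟩
    have ht' (i : ℕ) : MeasurableSet (t i) := ht i trivial
    simp only [Measure.infinitePi_pi _ fun i _ => ht' i]
    exact Finset.measurable_fun_prod _ fun i _ => Kernel.measurable_coe _ (ht' i)

variable {α : Type*} [MeasurableSpace α] {κ : Kernel α ℝ} [IsMarkovKernel κ]

instance : IsMarkovKernel (iidKernel κ) :=
  ⟨fun a => inferInstanceAs (IsProbabilityMeasure (Measure.infinitePi fun _ => κ a))⟩

lemma iidKernel_pi (a : α) (s : Finset ℕ) {t : ℕ → Set ℝ} (ht : ∀ i, MeasurableSet (t i)) :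
    iidKernel κ a ((s : Set ℕ).pi t) = ∏ i ∈ s, κ a (t i) :=
  Measure.infinitePi_pi _ fun i _ => ht i

lemma condDistrib_ae_eq_iidKernel {Ω : Type*} [MeasurableSpace Ω] {μ : Measure Ω}
    [IsFiniteMeasure μ] {T : Ω → α} (hT : Measurable T) {Y : Ω → ℕ → ℝ} (hY : Measurable Y)
    (h : ∀ (s : Finset ℕ) {t : ℕ → Set ℝ}, (∀ i, MeasurableSet (t i)) → ∀ {B : Set α},
      MeasurableSet B → μ (Y ⁻¹' (s : Set ℕ).pi t ∩ T ⁻¹' B) =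
        ∫⁻ ω in T ⁻¹' B, ∏ i ∈ s, κ (T ω) (t i) ∂μ) :
    condDistrib Y T μ =ᵐ[μ.map T] iidKernel κ := by
  refine condDistrib_ae_eq_of_measure_eq_compProd T hY.aemeasurable
    (Measure.ext_prod fun {B S} hB hS => ?_)
  have hbind {S : Set (ℕ → ℝ)} (hS : MeasurableSet S) :
      ((μ.map T).restrict B).bind (iidKernel κ) S = ∫⁻ ω in T ⁻¹' B, iidKernel κ (T ω) S ∂μ := by
    rw [Measure.bind_apply hS (Kernel.aemeasurable _),
      setLIntegral_map hB (Kernel.measurable_coe _ hS) hT]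
  have hrestrict : (μ.restrict (T ⁻¹' B)).map Y = ((μ.map T).restrict B).bind (iidKernel κ) := by
    refine ext_of_finset_pi fun s t ht => ?_
    have hs : MeasurableSet ((s : Set ℕ).pi t) := .pi s.countable_toSet fun i _ => ht i
    rw [hbind hs, Measure.map_apply hY hs, Measure.restrict_apply (hY hs), h s ht hB]
    simp only [iidKernel_pi _ s ht]
  rw [Measure.compProd_apply_prod hB hS, setLIntegral_map hB (Kernel.measurable_coe _ hS) hT,
    ← hbind hS, ← hrestrict, Measure.map_apply (hT.prodMk hY) (hB.prod hS),
    Measure.map_apply hY hS, Measure.restrict_apply (hY hS), Set.mk_preimage_prod, Set.inter_comm]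

end Iid

section DeFinetti

variable {Ω : Type*}

/-- The sequence observed from time `n` on. -/
def shift (g : ℕ → Ω → ℝ) (n : ℕ) (ω : Ω) (k : ℕ) : ℝ := g (n + k) ω

lemma comap_shift (g : ℕ → Ω → ℝ) (n : ℕ) :
    MeasurableSpace.comap (shift g n) inferInstance =
      ⨆ k, ⨆ _ : n ≤ k, MeasurableSpace.comap (g k) inferInstance := by
  rw [MeasurableSpace.pi, MeasurableSpace.comap_iSup]
  simp_rw [MeasurableSpace.comap_comp]
  refine le_antisymm (iSup_le fun k => le_iSup₂_of_le (n + k) le_self_add le_rfl)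
    (iSup₂_le fun k hk => le_iSup_of_le (k - n) ?_)
  rw [show (fun x : ℕ → ℝ => x (k - n)) ∘ shift g n = g k from
    funext fun ω => by simp [shift, Nat.add_sub_of_le hk]]

lemma comap_shift_antitone (g : ℕ → Ω → ℝ) :
    Antitone fun n => MeasurableSpace.comap (shift g n) inferInstance := by
  intro n N h
  simp only [comap_shift]
  exact iSup_mono fun k => iSup_mono' fun hk => ⟨h.trans hk, le_rfl⟩

lemma tail_eq_iInf_comap_shift (g : ℕ → Ω → ℝ) :
    tail g = ⨅ n, MeasurableSpace.comap (shift g n) inferInstance := by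
  simp only [comap_shift, tail]

lemma tail_le_comap_shift (g : ℕ → Ω → ℝ) (n : ℕ) :
    tail g ≤ MeasurableSpace.comap (shift g n) inferInstance :=
  (tail_eq_iInf_comap_shift g).trans_le (iInf_le _ n)

lemma measurable_limsup_tail {g u : ℕ → Ω → ℝ}
    (hu : ∀ n, Measurable[MeasurableSpace.comap (shift g n) inferInstance] (u n)) :
    Measurable[tail g] fun ω => limsup (fun n => u n ω) atTop := by
  intro s hs
  rw [tail_eq_iInf_comap_shift, MeasurableSpace.measurableSet_iInf]
  intro N
  have h : Measurable[MeasurableSpace.comap (shift g N) inferInstance]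
      fun ω => limsup (fun n => u (n + N) ω) atTop :=
    Measurable.limsup fun n => (hu (n + N)).mono (comap_shift_antitone g le_add_self) le_rfl
  have shift_limsup : (fun ω => limsup (fun n => u (n + N) ω) atTop) =
      fun ω => limsup (fun n => u n ω) atTop := funext fun ω => limsup_nat_add (u · ω) N
  exact shift_limsup ▸ h hs

variable [mΩ : MeasurableSpace Ω] {μ : Measure Ω} {g : ℕ → Ω → ℝ}

lemma measurable_shift (hg : ∀ n, Measurable (g n)) (n : ℕ) : Measurable (shift g n) :=
  measurable_pi_lambda _ fun _ => hg _

lemma Exchangeable.map_restrict_comp_injective (hg : ∀ n, Measurable (g n))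
    (h : Exchangeable μ g) {k : ℕ → ℕ} (hk : k.Injective) (I : Finset ℕ) :
    μ.map (fun ω => I.restrict fun j => g (k j) ω) =
      μ.map (fun ω => I.restrict fun j => g j ω) := by
  obtain ⟨n, hn⟩ : ∃ n, ∀ i ∈ I ∪ I.image k, i < n :=
    ⟨(I ∪ I.image k).sup id + 1, fun i hi => Nat.lt_succ_of_le (Finset.le_sup (f := id) hi)⟩
  have lt_n (i : I) : (i : ℕ) < n := hn _ (Finset.mem_union_left _ i.2)
  have k_lt_n (i : I) : k i < n := hn _ (Finset.mem_union_right _ (Finset.mem_image_of_mem k i.2))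
  let ι : I ↪ Fin n := ⟨fun i => ⟨i, lt_n i⟩, fun i j hij => Subtype.ext (Fin.mk.inj hij)⟩
  let κ : I ↪ Fin n := ⟨fun i => ⟨k i, k_lt_n i⟩, fun i j hij => Subtype.ext (hk (Fin.mk.inj hij))⟩
  let e := ι.toEquivRange.symm.trans κ.toEquivRange
  have extends_k (i : I) : e.extendSubtype (ι i) = κ i := by
    rw [Equiv.extendSubtype_apply_of_mem e _ ⟨i, rfl⟩]
    simp [e, Function.Embedding.toEquivRange_symm_apply_self]
  have hproj : Measurable fun (x : Fin n → ℝ) (i : I) => x (ι i) := by fun_prop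
  have key := congrArg (Measure.map fun (x : Fin n → ℝ) (i : I) => x (ι i)) (h n e.extendSubtype)
  rw [Measure.map_map hproj (by fun_prop), Measure.map_map hproj (by fun_prop)] at key
  convert! key using 2
  funext ω i
  exact congrArg (fun j : Fin n => g j ω) (extends_k i).symm

variable [IsProbabilityMeasure μ]

lemma Exchangeable.map_comp_injective (hg : ∀ n, Measurable (g n)) (h : Exchangeable μ g)
    {k : ℕ → ℕ} (hk : k.Injective) :
    μ.map (fun ω j => g (k j) ω) = μ.map (fun ω j => g j ω) :=
  (map_eq_iff_forall_finset_map_restrict_eq (by fun_prop) (by fun_prop)).2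
    (h.map_restrict_comp_injective hg hk)

lemma Exchangeable.map_shift_prodMk (hg : ∀ n, Measurable (g n)) (h : Exchangeable μ g)
    {a n : ℕ} (han : a < n) :
    μ.map (fun ω => (shift g n ω, g a ω)) = μ.map (fun ω => (shift g 1 ω, g 0 ω)) := by
  have split (b m : ℕ) (hbm : b < m) : μ.map (fun ω => (shift g m ω, g b ω)) =
      (μ.map fun ω j => g j ω).map fun x : ℕ → ℝ => (fun j => x (j + 1), x 0) := by
    have hk : (fun j => Nat.casesOn j b (m + ·) : ℕ → ℕ).Injective := by
      rintro (_ | i) (_ | j) (hij : _ = _)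
      all_goals simp_all
      all_goals omega
    rw [← h.map_comp_injective hg hk, Measure.map_map (by fun_prop) (by fun_prop)]
    rfl
  rw [split a n han, split 0 1 one_pos]

lemma Exchangeable.map_shift (hg : ∀ n, Measurable (g n)) (h : Exchangeable μ g) (n : ℕ) :
    μ.map (shift g n) = μ.map fun ω j => g j ω :=
  h.map_comp_injective hg (add_right_injective n)

/-- The regular conditional distribution of the first term given all the later ones. By
exchangeability it is also the one of `g a` given `shift g n`, for all `a < n`. -/
noncomputable def nextLaw (μ : Measure Ω) [IsFiniteMeasure μ] (g : ℕ → Ω → ℝ) :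
    Kernel (ℕ → ℝ) ℝ :=
  condDistrib (g 0) (shift g 1) μ

instance : IsMarkovKernel (nextLaw μ g) := by unfold nextLaw; infer_instance

instance (ω : Ω) : IsProbabilityMeasure (tailLaw μ g ω) := by unfold tailLaw; infer_instance

lemma Exchangeable.condExp_indicator_shift (hg : ∀ n, Measurable (g n)) (h : Exchangeable μ g)
    {a n : ℕ} (han : a < n) {s : Set ℝ} (hs : MeasurableSet s) :
    μ⟦g a ⁻¹' s | MeasurableSpace.comap (shift g n) inferInstance⟧ =ᵐ[μ]
      fun ω => (nextLaw μ g (shift g n ω)).real s := by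
  have same : condDistrib (g a) (shift g n) μ = nextLaw μ g := by
    simp only [nextLaw, condDistrib, h.map_shift_prodMk hg han]
  rw [← same]
  exact (condDistrib_ae_eq_condExp (measurable_shift hg n) (hg a) hs).symm

lemma norm_measureReal_le_one {α : Type*} [MeasurableSpace α] {ν : Measure α}
    [IsProbabilityMeasure ν] {s : Set α} : ‖ν.real s‖ ≤ 1 := by
  rw [Real.norm_of_nonneg measureReal_nonneg]
  exact measureReal_le_one

lemma condExp_ae_eq_self_of_variance_eq {m : MeasurableSpace Ω} (hm : m ≤ mΩ) {X : Ω → ℝ}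
    (hX : MemLp X 2 μ) (h : Var[μ[X | m]; μ] = Var[X; μ]) : μ[X | m] =ᵐ[μ] X := by
  have hE : MemLp (X - μ[X | m]) 2 μ := hX.sub (hX.condExp one_le_two)
  have hzero : ∫ ω, ((X - μ[X | m]) ^ 2) ω ∂μ = 0 := by
    have htotal := integral_condVar_add_variance_condExp hm hX
    rw [condVar, integral_condExp hm] at htotal
    exact add_eq_right.1 (htotal.trans h.symm)
  filter_upwards [(integral_eq_zero_iff_of_nonneg (fun ω => sq_nonneg _) hE.integrable_sq).1 hzero]
    with ω hω
  exact (sub_eq_zero.1 (pow_eq_zero_iff two_ne_zero |>.1 hω)).symm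

/-- The conditional probability given the times from `n` on is the conditional expectation of the
one given the times from `1` on. Both have the same law, hence the same variance, so they agree. -/
lemma Exchangeable.nextLaw_shift_ae_eq (hg : ∀ n, Measurable (g n)) (h : Exchangeable μ g)
    {n : ℕ} (hn : 0 < n) {s : Set ℝ} (hs : MeasurableSet s) :
    (fun ω => (nextLaw μ g (shift g n ω)).real s) =ᵐ[μ]
      fun ω => (nextLaw μ g (shift g 1 ω)).real s := by
  have hp : Measurable fun x => (nextLaw μ g x).real s :=
    (Kernel.measurable_coe _ hs).ennreal_toReal
  have hL (n : ℕ) : MemLp (fun ω => (nextLaw μ g (shift g n ω)).real s) 2 μ :=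
    .of_bound (hp.comp (measurable_shift hg n)).aestronglyMeasurable 1
      (.of_forall fun ω => norm_measureReal_le_one)
  have hvar (n : ℕ) : Var[fun ω => (nextLaw μ g (shift g n ω)).real s; μ] =
      Var[fun x => (nextLaw μ g x).real s; μ.map fun ω j => g j ω] := by
    rw [← h.map_shift hg n, variance_map hp.aemeasurable (measurable_shift hg n).aemeasurable]
    rfl
  have htower : μ[fun ω => (nextLaw μ g (shift g 1 ω)).real s |
      MeasurableSpace.comap (shift g n) inferInstance] =ᵐ[μ]
      fun ω => (nextLaw μ g (shift g n ω)).real s :=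
    calc _ =ᵐ[μ] _ := condExp_congr_ae (h.condExp_indicator_shift hg one_pos hs).symm
      _ =ᵐ[μ] _ := condExp_condExp_of_le (comap_shift_antitone g hn)
        (measurable_shift hg 1).comap_le
      _ =ᵐ[μ] _ := h.condExp_indicator_shift hg hn hs
  refine htower.symm.trans (condExp_ae_eq_self_of_variance_eq (measurable_shift hg n).comap_le
    (hL 1) ?_)
  rw [variance_congr htower, hvar, hvar]

lemma Exchangeable.nextLaw_shift_ae_eq_tailLaw (hg : ∀ n, Measurable (g n))
    (h : Exchangeable μ g) {s : Set ℝ} (hs : MeasurableSet s) :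
    (fun ω => (nextLaw μ g (shift g 1 ω)).real s) =ᵐ[μ] fun ω => (tailLaw μ g ω).real s := by
  let p (n : ℕ) (ω : Ω) : ℝ := (nextLaw μ g (shift g (n + 1) ω)).real s
  have hp (n : ℕ) : Measurable[MeasurableSpace.comap (shift g n) inferInstance] (p n) :=
    Measurable.mono (((Kernel.measurable_coe _ hs).ennreal_toReal).comp (comap_measurable _))
      (comap_shift_antitone g n.le_succ) le_rfl
  have hlimsup : (fun ω => limsup (p · ω) atTop) =ᵐ[μ] p 0 := by
    filter_upwards [ae_all_iff.2 fun n : ℕ => h.nextLaw_shift_ae_eq hg n.succ_pos hs] with ω hω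
    simp only [p, hω, limsup_const]
  have hint : Integrable (fun ω => limsup (p · ω) atTop) μ := by
    refine Integrable.congr ?_ hlimsup.symm
    exact .of_bound ((hp 0).mono (measurable_shift hg 0).comap_le le_rfl).aestronglyMeasurable 1
      (.of_forall fun ω => norm_measureReal_le_one)
  have htail : μ⟦g 0 ⁻¹' s | tail g⟧ =ᵐ[μ] fun ω => (tailLaw μ g ω).real s := by
    have := @condDistrib_ae_eq_condExp Ω Ω ℝ _ _ _ mΩ μ _ id (g 0) (tail g) s
      (measurable_id'' (tail_le hg)) (hg 0) hs
    rw [MeasurableSpace.comap_id] at this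
    exact this.symm
  calc p 0 =ᵐ[μ] _ := hlimsup.symm
    _ =ᵐ[μ] μ[fun ω => limsup (p · ω) atTop | tail g] := by
      rw [condExp_of_stronglyMeasurable (tail_le hg)
        (measurable_limsup_tail hp).stronglyMeasurable hint]
    _ =ᵐ[μ] μ[p 0 | tail g] := condExp_congr_ae hlimsup
    _ =ᵐ[μ] _ := condExp_congr_ae (h.condExp_indicator_shift hg one_pos hs).symm
    _ =ᵐ[μ] μ⟦g 0 ⁻¹' s | tail g⟧ :=
      condExp_condExp_of_le (tail_le_comap_shift g 1) (measurable_shift hg 1).comap_le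
    _ =ᵐ[μ] _ := htail

lemma Exchangeable.condExp_indicator_future (hg : ∀ n, Measurable (g n))
    (h : Exchangeable μ g) (a : ℕ) {s : Set ℝ} (hs : MeasurableSet s) :
    μ⟦g a ⁻¹' s | MeasurableSpace.comap (shift g (a + 1)) inferInstance⟧ =ᵐ[μ]
      fun ω => (tailLaw μ g ω).real s :=
  calc _ =ᵐ[μ] _ := h.condExp_indicator_shift hg a.lt_succ_self hs
    _ =ᵐ[μ] _ := h.nextLaw_shift_ae_eq hg a.succ_pos hs
    _ =ᵐ[μ] _ := h.nextLaw_shift_ae_eq_tailLaw hg hs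

lemma measurable_tailLaw_apply (hg : ∀ n, Measurable (g n)) {s : Set ℝ} (hs : MeasurableSet s) :
    Measurable fun ω => tailLaw μ g ω s :=
  (Kernel.measurable_coe (tailLaw μ g) hs).mono (tail_le hg) le_rfl

lemma Exchangeable.measure_preimage_inter_future (hg : ∀ n, Measurable (g n))
    (h : Exchangeable μ g) (a : ℕ) {s : Set ℝ} (hs : MeasurableSet s) {A : Set Ω}
    (hA : MeasurableSet[MeasurableSpace.comap (shift g (a + 1)) inferInstance] A) :
    μ (g a ⁻¹' s ∩ A) = ∫⁻ ω in A, tailLaw μ g ω s ∂μ := by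
  have hm := (measurable_shift hg (a + 1)).comap_le
  have hfin : ∫⁻ ω in A, tailLaw μ g ω s ∂μ ≠ ∞ :=
    ((setLIntegral_mono measurable_const fun ω _ => prob_le_one).trans_lt
      (by simp)).ne
  rw [← ENNReal.toReal_eq_toReal_iff' (by finiteness) hfin]
  calc μ.real (g a ⁻¹' s ∩ A)
    _ = ∫ ω in A, (g a ⁻¹' s).indicator (fun _ => 1) ω ∂μ := by
      simp [integral_indicator_const _ (hg a hs), measureReal_restrict_apply (hg a hs)]
    _ = ∫ ω in A, (μ⟦g a ⁻¹' s | MeasurableSpace.comap (shift g (a + 1)) inferInstance⟧) ω ∂μ :=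
      (setIntegral_condExp hm (.indicator (integrable_const 1) (hg a hs)) hA).symm
    _ = ∫ ω in A, (tailLaw μ g ω).real s ∂μ :=
      setIntegral_congr_ae (hm A hA) ((h.condExp_indicator_future hg a hs).mono fun ω hω _ => hω)
    _ = (∫⁻ ω in A, tailLaw μ g ω s ∂μ).toReal :=
      integral_toReal (measurable_tailLaw_apply hg hs).aemeasurable
        (.of_forall fun ω => measure_lt_top _ _)

lemma Exchangeable.lintegral_mul_indicator (hg : ∀ n, Measurable (g n)) (h : Exchangeable μ g)
    (a : ℕ) {s : Set ℝ} (hs : MeasurableSet s) {Φ : Ω → ℝ≥0∞}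
    (hΦ : Measurable[MeasurableSpace.comap (shift g (a + 1)) inferInstance] Φ) :
    ∫⁻ ω, Φ ω * s.indicator 1 (g a ω) ∂μ = ∫⁻ ω, Φ ω * tailLaw μ g ω s ∂μ := by
  have hm := (measurable_shift hg (a + 1)).comap_le
  have hind : (fun ω => Φ ω * s.indicator 1 (g a ω)) = (g a ⁻¹' s).indicator Φ :=
    funext fun ω => by by_cases hω : g a ω ∈ s <;> simp [hω]
  have htrim : (μ.restrict (g a ⁻¹' s)).trim hm =
      (μ.withDensity fun ω => tailLaw μ g ω s).trim hm := by
    refine @Measure.ext _ (_) _ _ fun A hA => ?_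
    rw [trim_measurableSet_eq hm hA, trim_measurableSet_eq hm hA, withDensity_apply _ (hm A hA),
      Measure.restrict_apply (hm A hA), Set.inter_comm, h.measure_preimage_inter_future hg a hs hA]
  rw [hind, lintegral_indicator (hg a hs), ← lintegral_trim hm hΦ, htrim, lintegral_trim hm hΦ,
    lintegral_withDensity_eq_lintegral_mul _ (measurable_tailLaw_apply hg hs) (hΦ.mono hm le_rfl)]
  simp only [Pi.mul_apply, mul_comm]

lemma Exchangeable.lintegral_mul_prod_indicator (hg : ∀ n, Measurable (g n))
    (h : Exchangeable μ g) {t : ℕ → Set ℝ} (ht : ∀ i, MeasurableSet (t i)) (s : Finset ℕ) :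
    ∀ {W : Ω → ℝ≥0∞}, Measurable[tail g] W →
      ∫⁻ ω, W ω * ∏ i ∈ s, (t i).indicator 1 (g i ω) ∂μ =
        ∫⁻ ω, W ω * ∏ i ∈ s, tailLaw μ g ω (t i) ∂μ := by
  induction s using Finset.induction_on_min with
  | empty => simp
  | insert a s ha ih =>
    intro W hW
    have ha' : a ∉ s := fun has => (ha a has).false
    have future {i : ℕ} (hi : i ∈ s) :
        Measurable[MeasurableSpace.comap (shift g (a + 1)) inferInstance] (g i) := by
      rw [comap_shift, measurable_iff_comap_le]
      exact le_iSup₂_of_le i (ha i hi) le_rfl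
    have hΦ : Measurable[MeasurableSpace.comap (shift g (a + 1)) inferInstance]
        fun ω => W ω * ∏ i ∈ s, (t i).indicator (1 : ℝ → ℝ≥0∞) (g i ω) :=
      (hW.mono (tail_le_comap_shift g _) le_rfl).mul <| Finset.measurable_fun_prod _ fun i hi =>
        (measurable_one.indicator (ht i)).comp (future hi)
    calc ∫⁻ ω, W ω * ∏ i ∈ insert a s, (t i).indicator 1 (g i ω) ∂μ
      _ = ∫⁻ ω, (W ω * ∏ i ∈ s, (t i).indicator 1 (g i ω)) * (t a).indicator 1 (g a ω) ∂μ := by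
        simp only [Finset.prod_insert ha', mul_assoc, mul_comm ((t a).indicator _ _)]
      _ = ∫⁻ ω, (W ω * ∏ i ∈ s, (t i).indicator 1 (g i ω)) * tailLaw μ g ω (t a) ∂μ :=
        h.lintegral_mul_indicator hg a (ht a) hΦ
      _ = ∫⁻ ω, (W ω * tailLaw μ g ω (t a)) * ∏ i ∈ s, (t i).indicator 1 (g i ω) ∂μ := by
        simp only [mul_right_comm]
      _ = ∫⁻ ω, (W ω * tailLaw μ g ω (t a)) * ∏ i ∈ s, tailLaw μ g ω (t i) ∂μ :=
        ih (hW.mul (Kernel.measurable_coe _ (ht a)))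
      _ = ∫⁻ ω, W ω * ∏ i ∈ insert a s, tailLaw μ g ω (t i) ∂μ := by
        simp only [Finset.prod_insert ha', mul_assoc]

lemma Exchangeable.measure_preimage_pi_inter_tail (hg : ∀ n, Measurable (g n))
    (h : Exchangeable μ g) (s : Finset ℕ) {t : ℕ → Set ℝ} (ht : ∀ i, MeasurableSet (t i))
    {B : Set Ω} (hB : MeasurableSet[tail g] B) :
    μ ((fun ω n => g n ω) ⁻¹' (s : Set ℕ).pi t ∩ B) =
      ∫⁻ ω in B, ∏ i ∈ s, tailLaw μ g ω (t i) ∂μ := by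
  have hS : MeasurableSet ((fun ω n => g n ω) ⁻¹' (s : Set ℕ).pi t) :=
    (measurable_pi_lambda _ hg) (.pi s.countable_toSet fun i _ => ht i)
  have hprod (ω : Ω) : ((fun ω n => g n ω) ⁻¹' (s : Set ℕ).pi t).indicator (1 : Ω → ℝ≥0∞) ω =
      ∏ i ∈ s, (t i).indicator 1 (g i ω) := by
    by_cases hω : ∀ i ∈ s, g i ω ∈ t i
    · have hmem : ω ∈ (fun ω n => g n ω) ⁻¹' (s : Set ℕ).pi t := hω
      rw [Set.indicator_of_mem hmem,
        Finset.prod_eq_one fun i hi => Set.indicator_of_mem (hω i hi) _, Pi.one_apply]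
    · have hnotMem : ω ∉ (fun ω n => g n ω) ⁻¹' (s : Set ℕ).pi t := hω
      rw [Set.indicator_of_notMem hnotMem]
      push Not at hω
      obtain ⟨i, hi, hit⟩ := hω
      exact (Finset.prod_eq_zero hi (Set.indicator_of_notMem hit _)).symm
  have restrict_eq (f : Ω → ℝ≥0∞) : ∫⁻ ω in B, f ω ∂μ = ∫⁻ ω, B.indicator 1 ω * f ω ∂μ := by
    rw [← lintegral_indicator (tail_le hg _ hB)]
    exact lintegral_congr fun ω => by by_cases hω : ω ∈ B <;> simp [hω]
  have hB1 : Measurable[tail g] (B.indicator (1 : Ω → ℝ≥0∞)) :=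
    (measurable_indicator_const_iff (m := tail g) (1 : ℝ≥0∞)).2 hB
  rw [restrict_eq, ← h.lintegral_mul_prod_indicator hg ht s hB1, ← restrict_eq]
  simp only [← hprod]
  rw [lintegral_indicator_one hS, Measure.restrict_apply hS]

instance : IsMarkovKernel (tailLaw μ g) := by unfold tailLaw; infer_instance

lemma Exchangeable.condDistrib_tail_ae_eq (hg : ∀ n, Measurable (g n)) (h : Exchangeable μ g) :
    @condDistrib Ω Ω (ℕ → ℝ) _ _ _ mΩ (tail g) (fun ω n => g n ω) id μ _ =ᵐ[μ]
      @iidKernel Ω (tail g) (tailLaw μ g) _ := by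
  have hid : Measurable[mΩ, tail g] id := measurable_id'' (tail_le hg)
  exact @ae_of_ae_map Ω Ω mΩ (tail g) _ _ (@Measurable.aemeasurable _ _ _ (tail g) _ _ hid) _
    (@condDistrib_ae_eq_iidKernel Ω (tail g) (tailLaw μ g) _ Ω mΩ μ _ id hid
    (fun ω n => g n ω) (measurable_pi_lambda _ hg) fun s t ht B hB =>
      h.measure_preimage_pi_inter_tail hg s ht hB)

/-- De Finetti's theorem. -/
lemma Exchangeable.condExp_tail_ae_eq (hg : ∀ n, Measurable (g n)) (h : Exchangeable μ g)
    {F : Ω × (ℕ → ℝ) → ℝ} (hF : StronglyMeasurable[(tail g).prod inferInstance] F)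
    (hint : Integrable (fun ω => F (ω, fun n => g n ω)) μ) :
    μ[fun ω => F (ω, fun n => g n ω) | tail g] =ᵐ[μ]
      fun ω => ∫ x, F (ω, x) ∂Measure.infinitePi fun _ => tailLaw μ g ω := by
  have key := @condExp_prod_ae_eq_integral_condDistrib Ω Ω (ℕ → ℝ) ℝ _ _ _ _ mΩ μ _ id
    (fun ω n => g n ω) (tail g) F _ _ (measurable_id'' (tail_le hg))
    (measurable_pi_lambda _ hg).aemeasurable hF hint
  rw [MeasurableSpace.comap_id] at key
  filter_upwards [key, h.condDistrib_tail_ae_eq hg] with ω h1 h2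
  simp only [id_eq] at h1
  rw [h1, h2]
  rfl

end DeFinetti

/-! ### Truncated and capped second moments -/

section FixedLaw

lemma measurableSet_abs_le (c : ℝ) : MeasurableSet {x : ℝ | |x| ≤ c} :=
  measurableSet_le measurable_norm measurable_const

lemma measurableSet_lt_abs (c : ℝ) : MeasurableSet {x : ℝ | c < |x|} :=
  measurableSet_lt measurable_const measurable_norm

/-- The truncated second moment `∫ x² 1_{|x| ≤ c} dν`, which is `t Σ_t(ε)` for `c = ε t` and the
conditional law `ν`. -/
noncomputable def truncMoment (ν : Measure ℝ) (c : ℝ) : ℝ :=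
  ∫ x, {y : ℝ | |y| ≤ c}.indicator (fun y => y ^ 2) x ∂ν

/-- The capped second moment `∫ (|x| ∧ c)² dν`, which is `t R_t(ε)` for `c = ε t` and the
conditional law `ν`. -/
noncomputable def cappedMoment (ν : Measure ℝ) (c : ℝ) : ℝ :=
  ∫ x, (min |x| c) ^ 2 ∂ν

lemma trunc_sq (c x : ℝ) : trunc c x ^ 2 = {y : ℝ | |y| ≤ c}.indicator (fun y => y ^ 2) x := by
  by_cases h : |x| ≤ c <;> simp [trunc, h]

lemma trunc_of_abs_le {c x : ℝ} (h : |x| ≤ c) : trunc c x = x :=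
  Set.indicator_of_mem (s := {y : ℝ | |y| ≤ c}) h _

lemma abs_trunc_le_abs (c x : ℝ) : |trunc c x| ≤ |x| :=
  norm_indicator_le_norm_self (fun y : ℝ => y) x

lemma truncMoment_nonneg (ν : Measure ℝ) (c : ℝ) : 0 ≤ truncMoment ν c :=
  integral_nonneg fun _ => Set.indicator_nonneg (fun _ _ => sq_nonneg _) _

lemma cappedMoment_nonneg (ν : Measure ℝ) (c : ℝ) : 0 ≤ cappedMoment ν c :=
  integral_nonneg fun _ => sq_nonneg _

lemma truncMoment_eq_integral_sq (ν : Measure ℝ) (c : ℝ) :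
    truncMoment ν c = ∫ x, trunc c x ^ 2 ∂ν := by
  simp only [truncMoment, trunc_sq]

lemma min_abs_sq_le {c : ℝ} (hc : 0 ≤ c) (x : ℝ) : (min |x| c) ^ 2 ≤ c ^ 2 :=
  pow_le_pow_left₀ (le_min (abs_nonneg x) hc) (min_le_right _ _) 2

variable (ν : Measure ℝ) [IsFiniteMeasure ν]

lemma memLp_two_trunc (c : ℝ) : MemLp (trunc c) 2 ν := memLp_trunc ν measurable_id c 2

lemma integrable_min_sq {c : ℝ} (hc : 0 ≤ c) : Integrable (fun x : ℝ => (min |x| c) ^ 2) ν :=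
  .of_bound (by fun_prop) (c ^ 2) (.of_forall fun x => by
    simpa only [Real.norm_of_nonneg (sq_nonneg _)] using min_abs_sq_le hc x)

lemma cappedMoment_eq_add (c : ℝ) :
    cappedMoment ν c = truncMoment ν c + c ^ 2 * ν.real {x | c < |x|} := by
  have split (x : ℝ) : (min |x| c) ^ 2 = {y : ℝ | |y| ≤ c}.indicator (fun y => y ^ 2) x
      + {y : ℝ | c < |y|}.indicator (fun _ => c ^ 2) x := by
    rcases le_or_gt |x| c with h | h
    · simp [h, h.not_gt]
    · simp [h, h.not_ge, h.le]
  have hsq := (memLp_two_trunc ν c).integrable_sq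
  simp only [trunc_sq] at hsq
  simp only [cappedMoment, split]
  rw [integral_add hsq ((integrable_const _).indicator (measurableSet_lt_abs c)),
    integral_indicator_const _ (measurableSet_lt_abs c), smul_eq_mul, mul_comm (c ^ 2),
    truncMoment]

lemma truncMoment_le_cappedMoment (c : ℝ) : truncMoment ν c ≤ cappedMoment ν c := by
  rw [cappedMoment_eq_add]
  exact le_add_of_nonneg_right (by positivity)

lemma cappedMoment_mono {b c : ℝ} (hb : 0 ≤ b) (hbc : b ≤ c) :
    cappedMoment ν b ≤ cappedMoment ν c :=
  integral_mono (integrable_min_sq ν hb) (integrable_min_sq ν (hb.trans hbc)) fun x =>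
    pow_le_pow_left₀ (le_min (abs_nonneg x) hb) (min_le_min_left _ hbc) 2

lemma three_fourths_mul_le_integral {α : Type*} [MeasurableSpace α] {ρ : Measure α}
    [IsProbabilityMeasure ρ] {A : Set α} (hA : MeasurableSet A) (hρ : ρ.real Aᶜ ≤ 1 / 4)
    {f : α → ℝ} (hf0 : 0 ≤ f) (hf : Integrable f ρ) {a : ℝ} (h : ∀ x ∈ A, a ≤ f x) :
    3 / 4 * a ≤ ∫ x, f x ∂ρ := by
  rcases le_or_gt a 0 with ha | ha
  · linarith [integral_nonneg (μ := ρ) hf0]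
  have hAge : 3 / 4 ≤ ρ.real {x | a ≤ f x} :=
    calc 3 / 4 ≤ ρ.real A := by linarith [probReal_compl_eq_one_sub (μ := ρ) hA]
      _ ≤ ρ.real {x | a ≤ f x} := measureReal_mono h
  calc 3 / 4 * a ≤ a * ρ.real {x | a ≤ f x} := by nlinarith
    _ ≤ ∫ x, f x ∂ρ := mul_meas_ge_le_integral_of_nonneg (.of_forall hf0) hf a

end FixedLaw

section Variance

variable (ν : Measure ℝ) [IsProbabilityMeasure ν]

lemma variance_trunc_eq (c : ℝ) :
    Var[trunc c; ν] = truncMoment ν c - (∫ x, trunc c x ∂ν) ^ 2 := by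
  rw [variance_eq_sub (memLp_two_trunc ν c), truncMoment_eq_integral_sq]
  rfl

lemma variance_trunc_le (c : ℝ) : Var[trunc c; ν] ≤ truncMoment ν c := by
  linarith [variance_trunc_eq ν c, sq_nonneg (∫ x, trunc c x ∂ν)]

lemma sq_integral_trunc_le (c : ℝ) : (∫ x, trunc c x ∂ν) ^ 2 ≤ truncMoment ν c := by
  linarith [variance_trunc_eq ν c, variance_nonneg (trunc c) ν]

/-- A mean `m` much larger than `K` puts most of the mass at distance about `|m|` from `m`. -/
lemma truncMoment_le_variance (c : ℝ) {K : ℝ} (hν : ν.real {x | K < |x|} ≤ 1 / 4) :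
    truncMoment ν c ≤ 4 * Var[trunc c; ν] + 2 * K ^ 2 := by
  set m := ∫ x, trunc c x ∂ν
  have hcompl : {x : ℝ | |x| ≤ K}ᶜ = {x | K < |x|} := by ext; simp
  have hvar : Var[trunc c; ν] = ∫ x, (trunc c x - m) ^ 2 ∂ν :=
    variance_eq_integral (measurable_trunc c).aemeasurable
  have hint : Integrable (fun x => 2 * (trunc c x - m) ^ 2) ν :=
    ((memLp_two_trunc ν c).sub (memLp_const m)).integrable_sq.const_mul 2
  have key : 3 / 4 * (m ^ 2 - 2 * K ^ 2) ≤ ∫ x, 2 * (trunc c x - m) ^ 2 ∂ν := by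
    refine three_fourths_mul_le_integral (measurableSet_abs_le K) (hcompl ▸ hν)
      (fun x => by positivity) hint fun x hx => ?_
    have hsq : trunc c x ^ 2 ≤ K ^ 2 := sq_le_sq.2
      ((abs_trunc_le_abs c x).trans (hx.trans (le_abs_self K)))
    nlinarith [sq_nonneg (2 * trunc c x - m)]
  rw [integral_const_mul, ← hvar] at key
  linarith [variance_trunc_eq ν c, variance_nonneg (trunc c) ν]

end Variance

/-! ### Averages over the truncation level -/

section Integrals

lemma setIntegral_Ioc_indicator_Iio {M a : ℝ} (hM : 0 ≤ M) (ha : 0 ≤ a) :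
    ∫ t in Set.Ioc 0 M, (Set.Iio a).indicator (fun t => t) t = (min M a) ^ 2 / 2 := by
  have hae : (Set.Ioc 0 M ∩ Set.Iio a : Set ℝ) =ᵐ[volume] Set.Ioc 0 (min M a) := by
    rw [← Set.Ioc_inter_Iic]
    exact (ae_eq_refl _).inter Iio_ae_eq_Iic
  rw [setIntegral_indicator measurableSet_Iio, setIntegral_congr_set hae,
    ← intervalIntegral.integral_of_le (le_min hM ha), integral_id]
  ring

lemma rpow_neg_three {t : ℝ} (ht : 0 < t) : t ^ (-3 : ℝ) = 1 / t ^ 3 := by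
  rw [Real.rpow_neg ht.le, one_div]
  norm_cast

lemma integrableOn_Ioi_inv_cube {c : ℝ} (hc : 0 < c) :
    IntegrableOn (fun t : ℝ => 1 / t ^ 3) (Set.Ioi c) :=
  (integrableOn_Ioi_rpow_of_lt (a := -3) (by norm_num) hc).congr_fun
    (fun _ ht => rpow_neg_three (hc.trans ht)) measurableSet_Ioi

lemma integral_Ioi_inv_cube {c : ℝ} (hc : 0 < c) :
    ∫ t in Set.Ioi c, 1 / t ^ 3 = 1 / (2 * c ^ 2) := by
  have hexp : (-3 + 1 : ℝ) = -(2 : ℕ) := by norm_num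
  rw [← setIntegral_congr_fun measurableSet_Ioi fun t ht => rpow_neg_three (hc.trans ht),
    integral_Ioi_rpow_of_lt (by norm_num) hc, hexp, Real.rpow_neg hc.le, Real.rpow_natCast]
  push_cast
  field_simp

/-- The integrand `x² 1_{|x| ≤ ε t} / t³` whose iterated integrals are, in one order, the average
of `Σ_t(ε)` and, in the other one, `R_M(ε)`. -/
noncomputable def truncSqDivCube (ε : ℝ) (p : ℝ × ℝ) : ℝ :=
  {p : ℝ × ℝ | |p.1| ≤ ε * p.2}.indicator (fun p => p.1 ^ 2 * (1 / p.2 ^ 3)) p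

lemma measurable_truncSqDivCube (ε : ℝ) : Measurable (truncSqDivCube ε) :=
  Measurable.indicator (by fun_prop) (measurableSet_le (by fun_prop) (by fun_prop))

lemma truncSqDivCube_nonneg (ε x : ℝ) {t : ℝ} (ht : 0 < t) : 0 ≤ truncSqDivCube ε (x, t) :=
  Set.indicator_apply_nonneg fun _ => by positivity

variable {ε M : ℝ}

lemma truncSqDivCube_eq_indicator_Ici (hε : 0 < ε) (x t : ℝ) :
    truncSqDivCube ε (x, t) = x ^ 2 * (Set.Ici (|x| / ε)).indicator (fun t => 1 / t ^ 3) t := by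
  by_cases h : |x| ≤ ε * t
  · simp [truncSqDivCube, h, div_le_iff₀' hε]
  · simp [truncSqDivCube, h, div_le_iff₀' hε]

lemma integrableOn_Ioi_truncSqDivCube (hε : 0 < ε) (hM : 0 < M) (x : ℝ) :
    IntegrableOn (fun t => truncSqDivCube ε (x, t)) (Set.Ioi M) := by
  simp only [truncSqDivCube_eq_indicator_Ici hε]
  exact ((integrableOn_Ioi_inv_cube hM).indicator measurableSet_Ici).const_mul _

lemma integral_Ioi_truncSqDivCube (hε : 0 < ε) (hM : 0 < M) (x : ℝ) :
    ∫ t in Set.Ioi M, truncSqDivCube ε (x, t) = 1 / (2 * M ^ 2) * (min |x| (ε * M)) ^ 2 := by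
  have hae : (Set.Ioi M ∩ Set.Ici (|x| / ε) : Set ℝ) =ᵐ[volume] Set.Ioi (max M (|x| / ε)) := by
    rw [← Set.Ioi_inter_Ioi]
    exact (ae_eq_refl _).inter Ioi_ae_eq_Ici.symm
  simp only [truncSqDivCube_eq_indicator_Ici hε]
  rw [integral_const_mul, setIntegral_indicator measurableSet_Ici, setIntegral_congr_set hae,
    integral_Ioi_inv_cube (lt_max_of_lt_left hM)]
  rcases le_total |x| (ε * M) with h | h
  · rw [min_eq_left h, max_eq_left (by rwa [div_le_iff₀' hε]), sq_abs]
    ring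
  · have hx : 0 < |x| := (mul_pos hε hM).trans_le h
    rw [min_eq_right h, max_eq_right (by rwa [le_div_iff₀' hε]), ← sq_abs x]
    field_simp

lemma integral_truncSqDivCube (ν : Measure ℝ) (ε t : ℝ) :
    ∫ x, truncSqDivCube ε (x, t) ∂ν = 1 / t * truncMoment ν (ε * t) / t ^ 2 := by
  have split (x : ℝ) : truncSqDivCube ε (x, t) =
      {y : ℝ | |y| ≤ ε * t}.indicator (fun y => y ^ 2) x * (1 / t ^ 3) := by
    by_cases h : |x| ≤ ε * t <;> simp [truncSqDivCube, h]
  simp only [split, integral_mul_const, truncMoment]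
  ring

variable (ν : Measure ℝ) [IsFiniteMeasure ν]

lemma integrable_truncSqDivCube (hε : 0 < ε) (hM : 0 < M) :
    Integrable (truncSqDivCube ε) (ν.prod (volume.restrict (Set.Ioi M))) := by
  refine (integrable_prod_iff (measurable_truncSqDivCube ε).aestronglyMeasurable).2
    ⟨.of_forall (integrableOn_Ioi_truncSqDivCube hε hM), ?_⟩
  refine ((integrable_min_sq ν (mul_pos hε hM).le).const_mul (1 / (2 * M ^ 2))).congr
    (.of_forall fun x => ?_)
  beta_reduce
  rw [← integral_Ioi_truncSqDivCube hε hM]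
  exact setIntegral_congr_fun measurableSet_Ioi fun t ht =>
    (Real.norm_of_nonneg (truncSqDivCube_nonneg ε x (hM.trans ht))).symm

lemma integrableOn_truncMoment (hε : 0 < ε) (hM : 0 < M) :
    IntegrableOn (fun t => 1 / t * truncMoment ν (ε * t) / t ^ 2) (Set.Ioi M) := by
  simpa only [integral_truncSqDivCube, IntegrableOn] using
    (integrable_truncSqDivCube ν hε hM).integral_prod_right

lemma setIntegral_truncMoment (hε : 0 < ε) (hM : 0 < M) :
    ∫ t in Set.Ioi M, 1 / t * truncMoment ν (ε * t) / t ^ 2 =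
      1 / (2 * M ^ 2) * cappedMoment ν (ε * M) := by
  have swap := integral_integral_swap (f := fun x t => truncSqDivCube ε (x, t))
    (integrable_truncSqDivCube ν hε hM)
  simp only [integral_Ioi_truncSqDivCube hε hM, integral_truncSqDivCube,
    integral_const_mul] at swap
  exact swap.symm

lemma setIntegral_mul_measureReal_lt (hε : 0 < ε) (hM : 0 < M) :
    ∫ t in Set.Ioc 0 M, t * ν.real {x : ℝ | ε * t < |x|} =
      1 / (2 * ε ^ 2) * cappedMoment ν (ε * M) := by
  let F (t x : ℝ) : ℝ := {p : ℝ × ℝ | ε * p.1 < |p.2|}.indicator (fun p => p.1) (t, x)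
  have hF : Integrable (Function.uncurry F) ((volume.restrict (Set.Ioc 0 M)).prod ν) := by
    have hmeas : Measurable (Function.uncurry F) :=
      measurable_fst.indicator (measurableSet_lt (by fun_prop) (by fun_prop))
    refine .of_bound hmeas.aestronglyMeasurable M ?_
    filter_upwards [Measure.quasiMeasurePreserving_fst.ae (ae_restrict_mem measurableSet_Ioc)]
      with p hp
    exact (norm_indicator_le_norm_self _ p).trans ((Real.norm_of_nonneg hp.1.le).trans_le hp.2)
  have inner_x (t : ℝ) : ∫ x, F t x ∂ν = t * ν.real {x : ℝ | ε * t < |x|} := by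
    rw [mul_comm, ← smul_eq_mul, ← integral_indicator_const t (measurableSet_lt_abs (ε * t))]
    rfl
  have inner_t (x : ℝ) :
      ∫ t in Set.Ioc 0 M, F t x = 1 / (2 * ε ^ 2) * (min |x| (ε * M)) ^ 2 := by
    have slice : (F · x) = (Set.Iio (|x| / ε)).indicator fun t => t := by
      funext t
      by_cases h : ε * t < |x| <;> simp [F, h, lt_div_iff₀' hε]
    have scale : min |x| (ε * M) = ε * min M (|x| / ε) := by
      rw [mul_min_of_nonneg _ _ hε.le, mul_div_cancel₀ _ hε.ne', min_comm]
    rw [slice, setIntegral_Ioc_indicator_Iio hM.le (by positivity), scale]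
    field_simp
  calc ∫ t in Set.Ioc 0 M, t * ν.real {x : ℝ | ε * t < |x|}
    _ = ∫ t in Set.Ioc 0 M, ∫ x, F t x ∂ν := by simp only [inner_x]
    _ = ∫ x, (∫ t in Set.Ioc 0 M, F t x) ∂ν := integral_integral_swap hF
    _ = 1 / (2 * ε ^ 2) * cappedMoment ν (ε * M) := by
      simp only [inner_t, integral_const_mul, cappedMoment]

end Integrals

section VarianceIntegral

variable {ε M : ℝ} (ν : Measure ℝ) [IsProbabilityMeasure ν]

lemma measurable_integral_trunc (ε : ℝ) : Measurable fun t : ℝ => ∫ x, trunc (ε * t) x ∂ν := by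
  have htrunc : Measurable (Function.uncurry fun t x : ℝ => trunc (ε * t) x) :=
    measurable_snd.indicator (s := {p : ℝ × ℝ | |p.2| ≤ ε * p.1})
      (measurableSet_le (by fun_prop) (by fun_prop))
  exact htrunc.stronglyMeasurable.integral_prod_right.measurable

lemma integrableOn_variance (hε : 0 < ε) (hM : 0 < M) :
    IntegrableOn (fun t => 1 / t * Var[trunc (ε * t); ν] / t ^ 2) (Set.Ioi M) := by
  have hS := integrableOn_truncMoment ν hε hM
  have hmeas : AEStronglyMeasurable (fun t => 1 / t * Var[trunc (ε * t); ν] / t ^ 2)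
      (volume.restrict (Set.Ioi M)) := by
    have hmean := measurable_integral_trunc ν ε
    have split (t : ℝ) : 1 / t * Var[trunc (ε * t); ν] / t ^ 2 =
        1 / t * truncMoment ν (ε * t) / t ^ 2 -
          1 / t * (∫ x, trunc (ε * t) x ∂ν) ^ 2 / t ^ 2 := by
      rw [variance_trunc_eq]
      ring
    simp only [split]
    exact hS.aestronglyMeasurable.sub (Measurable.aestronglyMeasurable (by fun_prop))
  refine hS.mono' hmeas ?_
  filter_upwards [ae_restrict_mem measurableSet_Ioi] with t ht
  have ht : 0 < t := hM.trans ht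
  have hvar := variance_nonneg (trunc (ε * t)) ν
  rw [Real.norm_of_nonneg (by positivity)]
  gcongr
  exact variance_trunc_le ν _

end VarianceIntegral

/-! ### Characteristic functions and capped second moments -/

section CharFun

variable (ρ : Measure ℝ) [IsProbabilityMeasure ρ]

lemma integrable_exp_mul_I (u : ℝ) :
    Integrable (fun x : ℝ => Complex.exp (u * x * Complex.I)) ρ :=
  .of_bound (by fun_prop) 1 (.of_forall fun x => by
    exact_mod_cast (Complex.norm_exp_ofReal_mul_I (u * x)).le)

lemma re_one_sub_charFun (u : ℝ) : (1 - charFun ρ u).re = ∫ x, (1 - Real.cos (u * x)) ∂ρ := by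
  have hcos : Integrable (fun x => Real.cos (u * x)) ρ :=
    .of_bound (by fun_prop) 1 (.of_forall fun x => Real.abs_cos_le_one _)
  have hre : (charFun ρ u).re = ∫ x, Real.cos (u * x) ∂ρ := by
    rw [charFun_apply_real]
    refine (integral_re (integrable_exp_mul_I ρ u)).symm.trans
      (integral_congr_ae (.of_forall fun x => ?_))
    exact_mod_cast Complex.exp_ofReal_mul_I_re (u * x)
  rw [Complex.sub_re, hre, integral_sub (integrable_const _) hcos]
  simp

variable {ρ} {c η : ℝ}

lemma measureReal_two_mul_lt_abs_le_of_charFun (hc : 0 < c)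
    (h : ∀ u : ℝ, |u| ≤ c⁻¹ → ‖1 - charFun ρ u‖ ≤ η) :
    ρ.real {x | 2 * c < |x|} ≤ 2 * η := by
  have hlen : 2 * (2 * c)⁻¹ = c⁻¹ := by field_simp
  have hint : ‖∫ u in (-2 * (2 * c)⁻¹)..(2 * (2 * c)⁻¹), 1 - charFun ρ u‖ ≤ η * (2 * c⁻¹) := by
    rw [neg_mul, hlen]
    refine (intervalIntegral.norm_integral_le_of_norm_le_const fun u hu => h u ?_).trans_eq ?_
    · rw [Set.uIoc_of_le (neg_le_self (by positivity))] at hu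
      exact abs_le.2 ⟨hu.1.le, hu.2⟩
    · rw [sub_neg_eq_add, abs_of_pos (by positivity), two_mul]
  calc ρ.real {x | 2 * c < |x|} ≤ 2⁻¹ * (2 * c) * (η * (2 * c⁻¹)) :=
        (measureReal_abs_gt_le_integral_charFun (by positivity)).trans (by gcongr)
    _ = 2 * η := by field_simp

lemma truncMoment_two_mul_le_of_charFun (hc : 0 < c)
    (h : ∀ u : ℝ, |u| ≤ c⁻¹ → ‖1 - charFun ρ u‖ ≤ η) :
    truncMoment ρ (2 * c) ≤ 5 * c ^ 2 * η := by
  have hpi : Real.pi ^ 2 < 10 := by nlinarith [Real.pi_lt_d2, Real.pi_pos]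
  have hcos (x : ℝ) : trunc (2 * c) x ^ 2 ≤ 5 * c ^ 2 * (1 - Real.cos (c⁻¹ * x)) := by
    rw [trunc_sq]
    refine Set.indicator_apply_le' (fun hx => ?_) fun _ => ?_
    · have habs : |c⁻¹ * x| ≤ Real.pi := by
        rw [abs_mul, abs_of_pos (inv_pos.2 hc), inv_mul_le_iff₀ hc]
        exact le_trans hx (by nlinarith [Real.pi_gt_three])
      have hle : (c⁻¹ * x) ^ 2 / 5 ≤ 1 - Real.cos (c⁻¹ * x) :=
        calc (c⁻¹ * x) ^ 2 / 5 = 2 / 10 * (c⁻¹ * x) ^ 2 := by ring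
          _ ≤ 2 / Real.pi ^ 2 * (c⁻¹ * x) ^ 2 := by gcongr
          _ ≤ 1 - Real.cos (c⁻¹ * x) := by linarith [Real.cos_le_one_sub_mul_cos_sq habs]
      calc x ^ 2 = 5 * c ^ 2 * ((c⁻¹ * x) ^ 2 / 5) := by field_simp
        _ ≤ _ := by gcongr
    · exact mul_nonneg (by positivity) (sub_nonneg.2 (Real.cos_le_one _))
  have hint : Integrable (fun x => 1 - Real.cos (c⁻¹ * x)) ρ :=
    .of_bound (by fun_prop) 2 (.of_forall fun x => by
      rw [Real.norm_eq_abs, abs_le]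
      constructor <;> linarith [Real.cos_le_one (c⁻¹ * x), Real.neg_one_le_cos (c⁻¹ * x)])
  calc truncMoment ρ (2 * c) ≤ ∫ x, 5 * c ^ 2 * (1 - Real.cos (c⁻¹ * x)) ∂ρ := by
        rw [truncMoment_eq_integral_sq]
        exact integral_mono (memLp_two_trunc ρ _).integrable_sq (hint.const_mul _) hcos
    _ = 5 * c ^ 2 * (1 - charFun ρ c⁻¹).re := by rw [integral_const_mul, re_one_sub_charFun]
    _ ≤ 5 * c ^ 2 * η := by
      gcongr
      exact (Complex.re_le_norm _).trans (h _ (abs_of_pos (inv_pos.2 hc)).le)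

lemma cappedMoment_le_of_charFun (hc : 0 < c)
    (h : ∀ u : ℝ, |u| ≤ c⁻¹ → ‖1 - charFun ρ u‖ ≤ η) :
    cappedMoment ρ c ≤ 13 * c ^ 2 * η :=
  calc cappedMoment ρ c ≤ cappedMoment ρ (2 * c) := cappedMoment_mono ρ hc.le (by linarith)
    _ = truncMoment ρ (2 * c) + (2 * c) ^ 2 * ρ.real {x | 2 * c < |x|} := cappedMoment_eq_add ρ _
    _ ≤ 5 * c ^ 2 * η + (2 * c) ^ 2 * (2 * η) := by
      gcongr
      · exact truncMoment_two_mul_le_of_charFun hc h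
      · exact measureReal_two_mul_lt_abs_le_of_charFun hc h
    _ = 13 * c ^ 2 * η := by ring

lemma norm_one_sub_charFun_le {u δ : ℝ} (hu : |u| ≤ 1) (hδ : 0 ≤ δ) :
    ‖1 - charFun ρ u‖ ≤ δ + 2 * ρ.real {x | δ < |x|} := by
  have hbound (x : ℝ) : ‖1 - Complex.exp (u * x * Complex.I)‖ ≤
      δ + {x | δ < |x|}.indicator (fun _ => 2) x := by
    rcases le_or_gt |x| δ with hx | hx
    · calc ‖1 - Complex.exp (u * x * Complex.I)‖ ≤ ‖u * x‖ := by
            rw [norm_sub_rev, mul_comm _ Complex.I]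
            exact_mod_cast Real.norm_exp_I_mul_ofReal_sub_one_le (x := u * x)
        _ ≤ δ := by
          rw [norm_mul]
          exact (mul_le_of_le_one_left (norm_nonneg x) hu).trans hx
        _ = _ := by simp [hx.not_gt]
    · calc ‖1 - Complex.exp (u * x * Complex.I)‖ ≤ 1 + 1 := by
            refine (norm_sub_le _ _).trans_eq ?_
            rw [norm_one, ← Complex.ofReal_mul, Complex.norm_exp_ofReal_mul_I]
        _ ≤ δ + 2 := by linarith
        _ = _ := by simp [hx]
  have hind : Integrable ({x : ℝ | δ < |x|}.indicator fun _ => (2 : ℝ)) ρ :=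
    (integrable_const _).indicator (measurableSet_lt_abs δ)
  calc ‖1 - charFun ρ u‖ = ‖∫ x, (1 - Complex.exp (u * x * Complex.I)) ∂ρ‖ := by
        rw [integral_sub (integrable_const _) (integrable_exp_mul_I ρ u), ← charFun_apply_real]
        simp
    _ ≤ ∫ x, (δ + {x | δ < |x|}.indicator (fun _ => 2) x) ∂ρ :=
      norm_integral_le_of_norm_le ((integrable_const _).add hind) (.of_forall hbound)
    _ = δ + 2 * ρ.real {x | δ < |x|} := by
      rw [integral_add (integrable_const _) hind,
        integral_indicator_const _ (measurableSet_lt_abs δ)]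
      simp [mul_comm]

end CharFun

section Symmetrization

variable (ν : Measure ℝ) [IsProbabilityMeasure ν]

/-- The law of the difference of two independent variables with law `ν`. -/
noncomputable def symmLaw (ν : Measure ℝ) : Measure ℝ := ν ∗ ν.map Neg.neg

instance : IsProbabilityMeasure (ν.map Neg.neg) :=
  Measure.isProbabilityMeasure_map measurable_neg.aemeasurable

instance : IsProbabilityMeasure (symmLaw ν) :=
  inferInstanceAs (IsProbabilityMeasure (ν ∗ ν.map Neg.neg))

lemma charFun_symmLaw (u : ℝ) : charFun (symmLaw ν) u = ((‖charFun ν u‖ ^ 2 : ℝ) : ℂ) := by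
  have hneg : charFun (ν.map Neg.neg) u = (starRingEnd ℂ) (charFun ν u) := by
    simpa only [neg_one_mul, charFun_neg] using charFun_map_mul (μ := ν) (-1) u
  rw [symmLaw, charFun_conv, hneg, Complex.mul_conj, Complex.normSq_eq_norm_sq]

lemma cappedMoment_symmLaw {c : ℝ} (hc : 0 ≤ c) :
    cappedMoment (symmLaw ν) c = ∫ x, ∫ y, (min |x - y| c) ^ 2 ∂ν ∂ν := by
  rw [cappedMoment, symmLaw, integral_conv (integrable_min_sq _ hc)]
  refine integral_congr_ae (.of_forall fun x => ?_)
  simp only [integral_map measurable_neg.aemeasurable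
    (show AEStronglyMeasurable (fun y => (min |x + y| c) ^ 2) _ by fun_prop), sub_eq_add_neg]

lemma min_abs_sq_le_sub {c : ℝ} (hc : 0 ≤ c) (x y : ℝ) :
    (min |x| c) ^ 2 ≤ 2 * (min |x - y| c) ^ 2 + 2 * y ^ 2 := by
  have htri : min |x| c ≤ min |x - y| c + |y| := by
    rw [← min_add_add_right]
    exact min_le_min (by simpa using abs_add_le (x - y) y) (by linarith [abs_nonneg y])
  calc (min |x| c) ^ 2 ≤ (min |x - y| c + |y|) ^ 2 :=
        pow_le_pow_left₀ (le_min (abs_nonneg _) hc) htri 2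
    _ ≤ 2 * ((min |x - y| c) ^ 2 + |y| ^ 2) := add_sq_le
    _ = 2 * (min |x - y| c) ^ 2 + 2 * y ^ 2 := by rw [sq_abs, mul_add]

/-- Integrate out `y` over `|y| ≤ K` only, an event of probability at least `3 / 4`. -/
lemma cappedMoment_le_symmLaw {c K : ℝ} (hc : 0 ≤ c) (hν : ν.real {x | K < |x|} ≤ 1 / 4) :
    3 / 4 * (cappedMoment ν c - 2 * K ^ 2) ≤ 2 * cappedMoment (symmLaw ν) c := by
  have hcompl : {x : ℝ | |x| ≤ K}ᶜ = {x | K < |x|} := by ext; simp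
  have hprod : Integrable (fun p : ℝ × ℝ => 2 * (min |p.1 - p.2| c) ^ 2) (ν.prod ν) :=
    .const_mul (.of_bound (by fun_prop) (c ^ 2) (.of_forall fun p => by
      simpa only [Real.norm_of_nonneg (sq_nonneg _)] using min_abs_sq_le hc (p.1 - p.2))) 2
  have hfiber (x : ℝ) : 3 / 4 * ((min |x| c) ^ 2 - 2 * K ^ 2) ≤
      ∫ y, 2 * (min |x - y| c) ^ 2 ∂ν := by
    refine three_fourths_mul_le_integral (measurableSet_abs_le K) (hcompl ▸ hν)
      (fun y => by positivity) ?_ fun y hy => ?_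
    · exact .const_mul (.of_bound (by fun_prop) (c ^ 2) (.of_forall fun y => by
        simpa only [Real.norm_of_nonneg (sq_nonneg _)] using min_abs_sq_le hc (x - y))) 2
    · have hyK : y ^ 2 ≤ K ^ 2 := sq_le_sq.2 (le_trans hy (le_abs_self K))
      linarith [min_abs_sq_le_sub hc x y]
  calc 3 / 4 * (cappedMoment ν c - 2 * K ^ 2)
      = ∫ x, 3 / 4 * ((min |x| c) ^ 2 - 2 * K ^ 2) ∂ν := by
        rw [integral_const_mul, integral_sub (integrable_min_sq ν hc) (integrable_const _)]
        simp [cappedMoment]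
    _ ≤ ∫ x, ∫ y, 2 * (min |x - y| c) ^ 2 ∂ν ∂ν :=
        integral_mono (((integrable_min_sq ν hc).sub (integrable_const _)).const_mul _)
          hprod.integral_prod_left hfiber
    _ = 2 * cappedMoment (symmLaw ν) c := by
        simp only [integral_const_mul, cappedMoment_symmLaw ν hc]

lemma mul_one_sub_sq_le_of_le_pow {x z : ℝ} {N : ℕ} (hx0 : 0 ≤ x) (hx1 : x ≤ 1)
    (hz : z ≤ 1 / 2) (h : 1 - z ≤ x ^ N) : N * (1 - x ^ 2) ≤ 4 * z := by
  have hsum : (N : ℝ) * x ^ N ≤ ∑ i ∈ Finset.range N, x ^ i := by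
    simpa using Finset.card_nsmul_le_sum (Finset.range N) (fun i => x ^ i) (x ^ N) fun i hi =>
      pow_le_pow_of_le_one hx0 hx1 (Finset.mem_range.1 hi).le
  have hgeom : (1 - x) * (N * x ^ N) ≤ z :=
    calc (1 - x) * (N * x ^ N) ≤ (1 - x) * ∑ i ∈ Finset.range N, x ^ i :=
          mul_le_mul_of_nonneg_left hsum (sub_nonneg.2 hx1)
      _ = 1 - x ^ N := mul_neg_geom_sum x N
      _ ≤ z := by linarith
  calc N * (1 - x ^ 2) = (1 + x) * ((1 - x) * (N * 1)) := by ring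
    _ ≤ 2 * ((1 - x) * (N * (2 * x ^ N))) := by
      have := sub_nonneg.2 hx1
      gcongr <;> linarith
    _ ≤ 4 * z := by linarith

lemma cappedMoment_le_of_norm_charFun_pow {N : ℕ} (hN : 0 < N) {z K : ℝ} (hz : z ≤ 1 / 2)
    (h : ∀ u : ℝ, |u| ≤ (N : ℝ)⁻¹ → 1 - z ≤ ‖charFun ν u‖ ^ N)
    (hν : ν.real {x | K < |x|} ≤ 1 / 4) :
    1 / N * cappedMoment ν N ≤ 156 * z + 2 * (K ^ 2 / N) := by
  have hN' : (0 : ℝ) < N := Nat.cast_pos.2 hN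
  have hchar (u : ℝ) (hu : |u| ≤ (N : ℝ)⁻¹) : ‖1 - charFun (symmLaw ν) u‖ ≤ 4 * z / N := by
    have hle : ‖charFun ν u‖ ≤ 1 := norm_charFun_le_one u
    rw [charFun_symmLaw, ← Complex.ofReal_one, ← Complex.ofReal_sub, Complex.norm_real,
      Real.norm_of_nonneg (sub_nonneg.2 (pow_le_one₀ (norm_nonneg _) hle)), le_div_iff₀' hN']
    exact mul_one_sub_sq_le_of_le_pow (norm_nonneg _) hle hz (h u hu)
  have hsymm : cappedMoment (symmLaw ν) N ≤ 52 * z * N :=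
    calc cappedMoment (symmLaw ν) N ≤ 13 * (N : ℝ) ^ 2 * (4 * z / N) :=
          cappedMoment_le_of_charFun hN' hchar
      _ = 52 * z * N := by field_simp; ring
  calc 1 / N * cappedMoment ν N ≤ 1 / N * (156 * z * N + 2 * K ^ 2) := by
        gcongr
        linarith [cappedMoment_le_symmLaw ν hN'.le hν, cappedMoment_nonneg (symmLaw ν) N]
    _ = 156 * z + 2 * (K ^ 2 / N) := by field_simp

end Symmetrization

/-! ### The weak law for independent variables and its converse -/

section IID

variable {α : Type*} [MeasurableSpace α] {P : Measure α} {ν : Measure ℝ} {X : ℕ → α → ℝ}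

lemma measurable_avg (hX : ∀ n, Measurable (X n)) (N : ℕ) : Measurable (avg X N) :=
  (Finset.measurable_sum _ fun n _ => hX n).const_mul _

lemma norm_charFun_map_avg_sub (hX : ∀ n, Measurable (X n)) (hind : iIndepFun X P)
    (hν : ∀ n, P.map (X n) = ν) (N : ℕ) (d u : ℝ) :
    ‖charFun (P.map fun a => avg X N a - d) u‖ = ‖charFun ν ((N : ℝ)⁻¹ * u)‖ ^ N := by
  have havg : P.map (avg X N) = P.map fun a => (1 / (N : ℝ)) * ∑ n ∈ Finset.range N, X n a := rfl
  have hshift : (P.map fun a => avg X N a - d) = (P.map (avg X N)).map (· + -d) := by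
    rw [Measure.map_map (by fun_prop) (measurable_avg hX N)]
    rfl
  have hsum : AEMeasurable (fun a => ∑ n ∈ Finset.range N, X n a) P :=
    (Finset.measurable_sum _ fun n _ => hX n).aemeasurable
  rw [hshift, charFun_map_add_const, norm_mul, Complex.norm_exp_ofReal_mul_I, mul_one, havg,
    charFun_map_mul_comp hsum,
    (hind.restrict _).charFun_map_fun_finsetSum_eq_prod fun n _ => (hX n).aemeasurable]
  simp [hν]

lemma cappedMoment_le_of_avg [IsProbabilityMeasure P] (hX : ∀ n, Measurable (X n))
    (hind : iIndepFun X P) (hν : ∀ n, P.map (X n) = ν) {N : ℕ} (hN : 0 < N) {d δ K : ℝ}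
    (hδ : 0 ≤ δ) (hsmall : δ + 2 * P.real {a | δ < |avg X N a - d|} ≤ 1 / 2)
    (hK : ν.real {x | K < |x|} ≤ 1 / 4) :
    1 / N * cappedMoment ν N ≤
      156 * (δ + 2 * P.real {a | δ < |avg X N a - d|}) + 2 * (K ^ 2 / N) := by
  have hmeas : Measurable fun a => avg X N a - d := (measurable_avg hX N).sub_const d
  have : IsProbabilityMeasure ν := hν 0 ▸ Measure.isProbabilityMeasure_map (hX 0).aemeasurable
  have : IsProbabilityMeasure (P.map fun a => avg X N a - d) :=
    Measure.isProbabilityMeasure_map hmeas.aemeasurable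
  have hN' : (0 : ℝ) < N := Nat.cast_pos.2 hN
  refine cappedMoment_le_of_norm_charFun_pow ν hN hsmall (fun u hu => ?_) hK
  have hNu : |N * u| ≤ 1 := by
    rw [abs_mul, abs_of_pos hN']
    exact (mul_le_mul_of_nonneg_left hu hN'.le).trans_eq (mul_inv_cancel₀ hN'.ne')
  have hdev := norm_one_sub_charFun_le (ρ := P.map fun a => avg X N a - d) hNu hδ
  rw [map_measureReal_apply hmeas (measurableSet_lt_abs δ)] at hdev
  calc 1 - (δ + 2 * P.real {a | δ < |avg X N a - d|})
      ≤ 1 - ‖1 - charFun (P.map fun a => avg X N a - d) (N * u)‖ := sub_le_sub_left hdev 1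
    _ ≤ ‖charFun (P.map fun a => avg X N a - d) (N * u)‖ := by
      simpa using norm_sub_norm_le (1 : ℂ) (1 - charFun (P.map fun a => avg X N a - d) (N * u))
    _ = ‖charFun ν u‖ ^ N := by
      rw [norm_charFun_map_avg_sub hX hind hν, inv_mul_cancel_left₀ hN'.ne']

lemma measureReal_exists_lt_abs_le (hX : ∀ n, Measurable (X n))
    (hν : ∀ n, P.map (X n) = ν) (N : ℕ) (c : ℝ) :
    P.real {a | ∃ n < N, c < |X n a|} ≤ N * ν.real {x | c < |x|} := by
  have hunion : {a | ∃ n < N, c < |X n a|} = ⋃ n ∈ Finset.range N, {a | c < |X n a|} := by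
    ext; simp
  have hterm (n : ℕ) : P.real {a | c < |X n a|} = ν.real {x | c < |x|} := by
    rw [← hν n, map_measureReal_apply (hX n) (measurableSet_lt_abs c)]
    rfl
  rw [hunion]
  refine (measureReal_biUnion_finset_le _ _).trans_eq ?_
  simp only [hterm, Finset.sum_const, Finset.card_range, nsmul_eq_mul]

lemma measureReal_avg_sub_le_of_variance [IsProbabilityMeasure P] (hX : ∀ n, MemLp (X n) 2 P)
    (hind : Pairwise fun i j => X i ⟂ᵢ[P] X j) {m v : ℝ} (hm : ∀ n, P[X n] = m)
    (hv : ∀ n, Var[X n; P] = v) {N : ℕ} (hN : 0 < N) {ε : ℝ} (hε : 0 < ε) :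
    P.real {a | ε < |avg X N a - m|} ≤ 1 / ε ^ 2 * (1 / N * v) := by
  have hN' : (N : ℝ) ≠ 0 := Nat.cast_ne_zero.2 hN.ne'
  have havg : avg X N = fun a => (1 / (N : ℝ)) * (∑ n ∈ Finset.range N, X n) a := by
    funext a
    rw [avg, Finset.sum_apply]
  have hmean : P[avg X N] = m := by
    rw [havg, integral_const_mul]
    simp only [Finset.sum_apply]
    rw [integral_finsetSum _ fun n _ => (hX n).integrable one_le_two]
    simp [hm, hN']
  have hvar : Var[avg X N; P] = 1 / N * v := by
    rw [havg, variance_const_mul, IndepFun.variance_sum (fun n _ => hX n)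
      fun i _ j _ hij => hind hij]
    simp only [hv, Finset.sum_const, Finset.card_range, nsmul_eq_mul]
    field_simp
  have hL2 : MemLp (avg X N) 2 P := havg ▸ (memLp_finsetSum' _ fun n _ => hX n).const_mul _
  have hvar0 : 0 ≤ Var[avg X N; P] / ε ^ 2 := div_nonneg (variance_nonneg _ _) (sq_nonneg ε)
  calc P.real {a | ε < |avg X N a - m|} ≤ P.real {a | ε ≤ |avg X N a - P[avg X N]|} :=
        measureReal_mono (by simpa only [hmean] using Set.ofPred_subset_ofPred.2 fun _ h => h.le)
    _ ≤ Var[avg X N; P] / ε ^ 2 :=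
      ENNReal.toReal_le_of_le_ofReal hvar0 (meas_ge_le_variance_div_sq hL2 hε)
    _ = 1 / ε ^ 2 * (1 / N * v) := by rw [hvar, div_eq_inv_mul, one_div (ε ^ 2)]

lemma measureReal_avg_trunc_sub_le [IsProbabilityMeasure P] (hX : ∀ n, Measurable (X n))
    (hind : iIndepFun X P) (hν : ∀ n, P.map (X n) = ν) {N : ℕ} (hN : 0 < N) (c : ℝ) {ε : ℝ}
    (hε : 0 < ε) :
    P.real {a | ε < |avg (fun n a => trunc c (X n a)) N a - ∫ x, trunc c x ∂ν|} ≤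
      1 / ε ^ 2 * (1 / N * truncMoment ν c) := by
  have : IsProbabilityMeasure ν := hν 0 ▸ Measure.isProbabilityMeasure_map (hX 0).aemeasurable
  have hmean (n : ℕ) : P[fun a => trunc c (X n a)] = ∫ x, trunc c x ∂ν := by
    rw [← hν n, integral_map (hX n).aemeasurable (measurable_trunc c).aestronglyMeasurable]
  have hvar (n : ℕ) : Var[fun a => trunc c (X n a); P] = Var[trunc c; ν] := by
    rw [← hν n, variance_map (measurable_trunc c).aemeasurable (hX n).aemeasurable]
    rfl
  refine (measureReal_avg_sub_le_of_variance (fun n => memLp_trunc P (hX n) c 2)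
    (fun i j hij => (hind.indepFun hij).comp (measurable_trunc c) (measurable_trunc c))
    hmean hvar hN hε).trans ?_
  gcongr
  exact variance_trunc_le ν c

lemma measureReal_avg_sub_le [IsProbabilityMeasure P] (hX : ∀ n, Measurable (X n))
    (hind : iIndepFun X P) (hν : ∀ n, P.map (X n) = ν) {N : ℕ} (hN : 0 < N) {ε : ℝ}
    (hε : 0 < ε) :
    P.real {a | ε < |avg X N a - ∫ x, trunc N x ∂ν|} ≤
      (1 + 1 / ε ^ 2) * (1 / N * cappedMoment ν N) := by
  have : IsProbabilityMeasure ν := hν 0 ▸ Measure.isProbabilityMeasure_map (hX 0).aemeasurable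
  have hcover : {a | ε < |avg X N a - ∫ x, trunc N x ∂ν|} ⊆ {a | ∃ n < N, (N : ℝ) < |X n a|} ∪
      {a | ε < |avg (fun n a => trunc N (X n a)) N a - ∫ x, trunc N x ∂ν|} := by
    intro a ha
    by_cases hex : ∃ n < N, (N : ℝ) < |X n a|
    · exact .inl hex
    · push Not at hex
      have havg : avg (fun n a => trunc N (X n a)) N a = avg X N a := by
        rw [avg, avg, Finset.sum_congr rfl fun n hn => trunc_of_abs_le
          (hex n (Finset.mem_range.1 hn))]
      exact .inr (by rwa [Set.mem_ofPred_eq, havg])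
  have htail : N * ν.real {x | (N : ℝ) < |x|} ≤ 1 / N * cappedMoment ν N := by
    have hN' : (N : ℝ) ≠ 0 := Nat.cast_ne_zero.2 hN.ne'
    rw [cappedMoment_eq_add]
    calc N * ν.real {x | (N : ℝ) < |x|}
        = 1 / N * (0 + (N : ℝ) ^ 2 * ν.real {x | (N : ℝ) < |x|}) := by field_simp; ring
      _ ≤ _ := by
        gcongr
        exact truncMoment_nonneg ν N
  calc P.real {a | ε < |avg X N a - ∫ x, trunc N x ∂ν|}
      ≤ N * ν.real {x | (N : ℝ) < |x|} + 1 / ε ^ 2 * (1 / N * truncMoment ν N) :=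
        (measureReal_mono hcover).trans <| (measureReal_union_le _ _).trans <|
          add_le_add (measureReal_exists_lt_abs_le hX hν N N)
            (measureReal_avg_trunc_sub_le hX hind hν hN N hε)
    _ ≤ 1 / N * cappedMoment ν N + 1 / ε ^ 2 * (1 / N * cappedMoment ν N) := by
        gcongr
        exact truncMoment_le_cappedMoment ν N
    _ = (1 + 1 / ε ^ 2) * (1 / N * cappedMoment ν N) := by ring

end IID

/-! ### Convergence to zero in measure -/

section InMeasure

variable {Ω ι : Type*} [mΩ : MeasurableSpace Ω] {μ : Measure Ω} {l : Filter ι}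

section Comparison

variable [IsFiniteMeasure μ] {F G H : ι → Ω → ℝ}

lemma tendstoInMeasure_zero_iff : TendstoInMeasure μ F l (fun _ => 0) ↔
    ∀ δ, 0 < δ → Tendsto (fun i => μ.real {ω | δ ≤ |F i ω|}) l (𝓝 0) := by
  simp only [tendstoInMeasure_iff_measureReal_norm, sub_zero, Real.norm_eq_abs]

lemma tendstoInMeasure_zero_of_abs_lt
    (h : ∀ δ, 0 < δ → ∃ G H : ι → Ω → ℝ, TendstoInMeasure μ G l (fun _ => 0) ∧
      TendstoInMeasure μ H l (fun _ => 0) ∧ ∃ η, 0 < η ∧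
        ∀ᶠ i in l, ∀ ω, |G i ω| < η → |H i ω| < η → |F i ω| < δ) :
    TendstoInMeasure μ F l (fun _ => 0) := by
  refine tendstoInMeasure_zero_iff.2 fun δ hδ => ?_
  obtain ⟨G, H, hG, hH, η, hη, hF⟩ := h δ hδ
  have hsum := (tendstoInMeasure_zero_iff.1 hG η hη).add (tendstoInMeasure_zero_iff.1 hH η hη)
  rw [add_zero] at hsum
  refine squeeze_zero' (.of_forall fun _ => measureReal_nonneg) ?_ hsum
  filter_upwards [hF] with i hi
  refine (measureReal_mono fun ω hω => ?_).trans (measureReal_union_le _ _)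
  by_contra hnot
  simp only [Set.mem_union, Set.mem_ofPred_eq, not_or, not_le] at hnot
  exact (hi ω hnot.1 hnot.2).not_ge hω

lemma tendstoInMeasure_zero_of_abs_le_add_error (hG : TendstoInMeasure μ G l (fun _ => 0))
    (hH : TendstoInMeasure μ H l (fun _ => 0)) {e : ι → ℝ} (he : Tendsto e l (𝓝 0)) {c C : ℝ}
    (hc : 0 < c) (hC : 0 < C)
    (h : ∀ᶠ i in l, ∀ ω, |H i ω| < c → |F i ω| ≤ C * |G i ω| + e i) :
    TendstoInMeasure μ F l (fun _ => 0) := by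
  refine tendstoInMeasure_zero_of_abs_lt fun δ hδ => ⟨G, H, hG, hH, min c (δ / (2 * C)),
    by positivity, ?_⟩
  filter_upwards [h, he.eventually_lt_const (half_pos hδ)] with i hi hei ω hGω hHω
  have hCG : C * |G i ω| < δ / 2 := by
    calc C * |G i ω| < C * (δ / (2 * C)) := by
          gcongr
          exact hGω.trans_le (min_le_right _ _)
      _ = δ / 2 := by field_simp
  linarith [hi ω (hHω.trans_le (min_le_left _ _))]

lemma tendstoInMeasure_zero_of_abs_le_mul (hG : TendstoInMeasure μ G l (fun _ => 0)) {C : ℝ}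
    (hC : 0 < C) (h : ∀ᶠ i in l, ∀ ω, |F i ω| ≤ C * |G i ω|) :
    TendstoInMeasure μ F l (fun _ => 0) :=
  tendstoInMeasure_zero_of_abs_le_add_error hG hG tendsto_const_nhds one_pos hC
    (h.mono fun i hi ω _ => by simpa using hi ω)

lemma tendstoInMeasure_zero_congr_mul {C : ℝ} (hC : 0 < C)
    (h : ∀ᶠ i in l, ∀ ω, F i ω = C * G i ω) :
    TendstoInMeasure μ F l (fun _ => 0) ↔ TendstoInMeasure μ G l (fun _ => 0) := by
  constructor <;> intro h0
  · refine tendstoInMeasure_zero_of_abs_le_mul h0 (inv_pos.2 hC) (h.mono fun i hi ω => ?_)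
    rw [hi, abs_mul, abs_of_pos hC, inv_mul_cancel_left₀ hC.ne']
  · refine tendstoInMeasure_zero_of_abs_le_mul h0 hC (h.mono fun i hi ω => ?_)
    rw [hi, abs_mul, abs_of_pos hC]

lemma tendstoInMeasure_zero_add (hG : TendstoInMeasure μ G l (fun _ => 0))
    (hH : TendstoInMeasure μ H l (fun _ => 0)) :
    TendstoInMeasure μ (fun i ω => G i ω + H i ω) l (fun _ => 0) :=
  tendstoInMeasure_zero_of_abs_lt fun δ hδ => ⟨G, H, hG, hH, δ / 2, half_pos hδ,
    .of_forall fun i ω hGω hHω => by linarith [abs_add_le (G i ω) (H i ω)]⟩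

end Comparison

section CondProb

variable [IsProbabilityMeasure μ]

lemma integral_le_add_measureReal {f : Ω → ℝ} (hf : Measurable f) (hf0 : 0 ≤ᵐ[μ] f)
    (hf1 : f ≤ᵐ[μ] 1) {η : ℝ} (hη : 0 ≤ η) : ∫ ω, f ω ∂μ ≤ η + μ.real {ω | η ≤ |f ω|} := by
  have hS : MeasurableSet {ω | η ≤ |f ω|} := measurableSet_le measurable_const hf.abs
  calc ∫ ω, f ω ∂μ ≤ ∫ ω, (η + {ω | η ≤ |f ω|}.indicator 1 ω) ∂μ := by
        refine integral_mono_of_nonneg hf0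
          ((integrable_const _).add ((integrable_const _).indicator hS)) ?_
        filter_upwards [hf1] with ω hω
        by_cases h : η ≤ |f ω|
        · simpa [h] using hω.trans (le_add_of_nonneg_left hη)
        · simpa [h] using (le_abs_self _).trans (not_le.1 h).le
    _ = η + μ.real {ω | η ≤ |f ω|} := by
      rw [integral_add (integrable_const _) ((integrable_const _).indicator hS),
        integral_indicator_one hS]
      simp

lemma tendstoInMeasure_zero_iff_tendsto_integral {F : ι → Ω → ℝ} (hF : ∀ i, Measurable (F i))
    (hF0 : ∀ i, 0 ≤ᵐ[μ] F i) (hF1 : ∀ i, F i ≤ᵐ[μ] 1) :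
    TendstoInMeasure μ F l (fun _ => 0) ↔ Tendsto (fun i => ∫ ω, F i ω ∂μ) l (𝓝 0) := by
  have hI (i : ι) : 0 ≤ ∫ ω, F i ω ∂μ := integral_nonneg_of_ae (hF0 i)
  refine tendstoInMeasure_zero_iff.trans ⟨fun h => ?_, fun h δ hδ => ?_⟩
  · refine tendsto_order.2 ⟨fun a ha => .of_forall fun i => ha.trans_le (hI i), fun a ha => ?_⟩
    filter_upwards [(h (a / 2) (half_pos ha)).eventually_lt_const (half_pos ha)] with i hi
    linarith [integral_le_add_measureReal (hF i) (hF0 i) (hF1 i) (half_pos ha).le]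
  · have hδlim := h.div_const δ
    rw [zero_div] at hδlim
    refine squeeze_zero (fun _ => measureReal_nonneg) (fun i => ?_) hδlim
    have hint : Integrable (F i) μ := .of_bound (hF i).aestronglyMeasurable 1 <| by
      filter_upwards [hF0 i, hF1 i] with ω h0 h1
      rwa [Real.norm_of_nonneg h0]
    have habs : ∫ ω, |F i ω| ∂μ = ∫ ω, F i ω ∂μ :=
      integral_congr_ae ((hF0 i).mono fun ω hω => abs_of_nonneg hω)
    rw [le_div_iff₀' hδ, ← habs]
    exact mul_meas_ge_le_integral_of_nonneg (.of_forall fun ω => abs_nonneg _) hint.abs δ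

lemma tendstoInMeasure_condExp_indicator_iff {m : MeasurableSpace Ω} (hm : m ≤ mΩ)
    {A : ι → Set Ω} (hA : ∀ i, MeasurableSet[mΩ] (A i)) :
    TendstoInMeasure μ (fun i => μ⟦A i | m⟧) l (fun _ => 0) ↔
      Tendsto (fun i => μ.real (A i)) l (𝓝 0) := by
  have hint (i : ι) : Integrable ((A i).indicator fun _ => (1 : ℝ)) μ :=
    (integrable_const _).indicator (hA i)
  have hle (i : ι) : μ⟦A i | m⟧ ≤ᵐ[μ] 1 := by
    have := condExp_mono (m := m) (hint i) (integrable_const (1 : ℝ))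
      (.of_forall fun ω => Set.indicator_le_self' (fun _ _ => zero_le_one) ω)
    rwa [condExp_const hm] at this
  rw [tendstoInMeasure_zero_iff_tendsto_integral (mΩ := mΩ)
    (fun i => (stronglyMeasurable_condExp.mono hm).measurable)
    (fun i => condExp_nonneg (.of_forall (Set.indicator_nonneg fun _ _ => zero_le_one))) hle]
  simp only [integral_condExp hm, integral_indicator_const _ (hA _), smul_eq_mul, mul_one]

end CondProb

end InMeasure

/-! ### Conditional laws given the tail -/

section Conditional

variable {Ω : Type*} [mΩ : MeasurableSpace Ω] {μ : Measure Ω} [IsProbabilityMeasure μ]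
  {g : ℕ → Ω → ℝ}

lemma tendsto_measureReal_lt_abs (ν : Measure ℝ) [IsFiniteMeasure ν] :
    Tendsto (fun n : ℕ => ν.real {x | (n : ℝ) < |x|}) atTop (𝓝 0) := by
  have h := tendsto_measure_iInter_atTop (μ := ν) (s := fun n : ℕ => {x : ℝ | (n : ℝ) < |x|})
    (fun n => (measurableSet_lt_abs n).nullMeasurableSet)
    (fun m n hmn x (hx : (n : ℝ) < |x|) => (Nat.cast_le.2 hmn).trans_lt hx) ⟨0, measure_ne_top _ _⟩
  have hempty : ⋂ n : ℕ, {x : ℝ | (n : ℝ) < |x|} = ∅ := by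
    refine Set.eq_empty_of_forall_notMem fun x hx => ?_
    obtain ⟨n, hn⟩ := exists_nat_gt |x|
    exact hn.not_gt (Set.mem_iInter.1 hx n)
  rw [hempty, measure_empty] at h
  exact (ENNReal.tendsto_toReal_zero_iff fun n => measure_ne_top _ _).2 h

lemma tendstoInMeasure_tailLaw_lt_abs {ι : Type*} {l : Filter ι} (hg : ∀ n, Measurable (g n))
    {K : ι → ℝ} (hK : Tendsto K l atTop) :
    TendstoInMeasure μ (fun i ω => (tailLaw μ g ω).real {x | K i < |x|}) l (fun _ => 0) := by
  have hnat : TendstoInMeasure μ (fun (n : ℕ) ω => (tailLaw μ g ω).real {x | (n : ℝ) < |x|})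
      atTop (fun _ => 0) :=
    tendstoInMeasure_of_tendsto_ae (fun n => (measurable_tailLaw_apply hg
      (measurableSet_lt_abs n)).ennreal_toReal.aestronglyMeasurable)
      (.of_forall fun ω => tendsto_measureReal_lt_abs _)
  refine tendstoInMeasure_zero_of_abs_le_mul (hnat.comp (tendsto_nat_floor_atTop.comp hK))
    one_pos ?_
  filter_upwards [hK.eventually_ge_atTop 0] with i hi ω
  rw [one_mul, abs_of_nonneg measureReal_nonneg]
  refine (measureReal_mono fun x hx => ?_).trans (le_abs_self _)
  exact (Nat.floor_le hi).trans_lt hx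

lemma tendsto_sqrt_sqrt_atTop : Tendsto (fun t : ℝ => √√t) atTop atTop :=
  Real.tendsto_sqrt_atTop.comp Real.tendsto_sqrt_atTop

lemma tendsto_sq_sqrt_sqrt_div : Tendsto (fun t : ℝ => √√t ^ 2 / t) atTop (𝓝 0) := by
  refine (tendsto_inv_atTop_zero.comp Real.tendsto_sqrt_atTop).congr fun t => ?_
  rw [Real.sq_sqrt (Real.sqrt_nonneg t), Real.sqrt_div_self', one_div, Function.comp_apply]

lemma condSecond_eq_truncMoment (ε t : ℝ) (ω : Ω) :
    condSecond μ g ε t ω = 1 / t * truncMoment (tailLaw μ g ω) (ε * t) := rfl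

lemma condTruncSecond_eq_cappedMoment (ε t : ℝ) (ω : Ω) :
    condTruncSecond μ g ε t ω = 1 / t * cappedMoment (tailLaw μ g ω) (ε * t) := rfl

lemma condSecond_nonneg {ε t : ℝ} (ht : 0 ≤ t) (ω : Ω) : 0 ≤ condSecond μ g ε t ω :=
  mul_nonneg (one_div_nonneg.2 ht) (truncMoment_nonneg _ _)

lemma condVariance_nonneg {ε t : ℝ} (ht : 0 ≤ t) (ω : Ω) : 0 ≤ condVariance μ g ε t ω :=
  mul_nonneg (one_div_nonneg.2 ht) (variance_nonneg _ _)

lemma condTail_nonneg {ε t : ℝ} (ht : 0 ≤ t) (ω : Ω) : 0 ≤ condTail μ g ε t ω :=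
  mul_nonneg ht measureReal_nonneg

lemma condTruncSecond_nonneg {ε t : ℝ} (ht : 0 ≤ t) (ω : Ω) : 0 ≤ condTruncSecond μ g ε t ω :=
  mul_nonneg (one_div_nonneg.2 ht) (cappedMoment_nonneg _ _)

lemma condTruncSecond_eq_add {t : ℝ} (ht : t ≠ 0) (ε : ℝ) (ω : Ω) :
    condTruncSecond μ g ε t ω = condSecond μ g ε t ω + ε ^ 2 * condTail μ g ε t ω := by
  rw [condTruncSecond_eq_cappedMoment, cappedMoment_eq_add, condSecond_eq_truncMoment, condTail]
  field_simp

lemma condVariance_le_condSecond {t : ℝ} (ht : 0 ≤ t) (ε : ℝ) (ω : Ω) :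
    condVariance μ g ε t ω ≤ condSecond μ g ε t ω :=
  mul_le_mul_of_nonneg_left (variance_trunc_le _ _) (one_div_nonneg.2 ht)

lemma condSecond_le_condVariance {t : ℝ} (ht : 0 ≤ t) (ε : ℝ) {K : ℝ} {ω : Ω}
    (hK : (tailLaw μ g ω).real {x | K < |x|} ≤ 1 / 4) :
    condSecond μ g ε t ω ≤ 4 * condVariance μ g ε t ω + 2 * (K ^ 2 / t) := by
  calc condSecond μ g ε t ω
      ≤ 1 / t * (4 * Var[trunc (ε * t); tailLaw μ g ω] + 2 * K ^ 2) :=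
        mul_le_mul_of_nonneg_left (truncMoment_le_variance _ _ hK) (one_div_nonneg.2 ht)
    _ = 4 * condVariance μ g ε t ω + 2 * (K ^ 2 / t) := by
      rw [condVariance]
      ring

lemma sq_condMean_div_sqrt_le {N : ℝ} (hN : 0 ≤ N) (ω : Ω) :
    (condMean μ g 1 N ω / √N) ^ 2 ≤ condTruncSecond μ g 1 N ω := by
  rw [div_pow, Real.sq_sqrt hN, div_eq_inv_mul, inv_eq_one_div]
  exact mul_le_mul_of_nonneg_left
    ((sq_integral_trunc_le _ _).trans (truncMoment_le_cappedMoment _ _)) (one_div_nonneg.2 hN)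

lemma average_condTail {ε M : ℝ} (hε : 0 < ε) (hM : 0 < M) (ω : Ω) :
    1 / M * ∫ t in Set.Ioc 0 M, condTail μ g ε t ω =
      1 / (2 * ε ^ 2) * condTruncSecond μ g ε M ω := by
  simp only [condTail, setIntegral_mul_measureReal_lt _ hε hM]
  rw [condTruncSecond_eq_cappedMoment, mul_left_comm]

lemma average_condSecond {ε M : ℝ} (hε : 0 < ε) (hM : 0 < M) (ω : Ω) :
    M * ∫ t in Set.Ioi M, condSecond μ g ε t ω / t ^ 2 = 1 / 2 * condTruncSecond μ g ε M ω := by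
  simp only [condSecond_eq_truncMoment, setIntegral_truncMoment _ hε hM]
  rw [condTruncSecond_eq_cappedMoment]
  field_simp

lemma average_condVariance_le {ε M : ℝ} (hε : 0 < ε) (hM : 0 < M) (ω : Ω) :
    M * ∫ t in Set.Ioi M, condVariance μ g ε t ω / t ^ 2 ≤
      M * ∫ t in Set.Ioi M, condSecond μ g ε t ω / t ^ 2 := by
  refine mul_le_mul_of_nonneg_left (setIntegral_mono_on (integrableOn_variance _ hε hM)
    (integrableOn_truncMoment _ hε hM) measurableSet_Ioi fun t ht => ?_) hM.le
  exact div_le_div_of_nonneg_right (condVariance_le_condSecond (hM.trans ht).le ε ω) (sq_nonneg t)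

lemma average_condSecond_le {ε M : ℝ} (hε : 0 < ε) (hM : 0 < M) {K : ℝ} {ω : Ω}
    (hK : (tailLaw μ g ω).real {x | K < |x|} ≤ 1 / 4) :
    M * ∫ t in Set.Ioi M, condSecond μ g ε t ω / t ^ 2 ≤
      4 * (M * ∫ t in Set.Ioi M, condVariance μ g ε t ω / t ^ 2) + K ^ 2 / M := by
  have hV : IntegrableOn (fun t => 4 * (condVariance μ g ε t ω / t ^ 2)) (Set.Ioi M) :=
    (integrableOn_variance _ hε hM).const_mul 4
  have hcube := (integrableOn_Ioi_inv_cube hM).const_mul (2 * K ^ 2)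
  have hle : ∫ t in Set.Ioi M, condSecond μ g ε t ω / t ^ 2 ≤ ∫ t in Set.Ioi M,
      (4 * (condVariance μ g ε t ω / t ^ 2) + 2 * K ^ 2 * (1 / t ^ 3)) := by
    refine setIntegral_mono_on (integrableOn_truncMoment _ hε hM) (hV.add hcube)
      measurableSet_Ioi fun t ht => ?_
    have ht0 : 0 < t := hM.trans ht
    calc condSecond μ g ε t ω / t ^ 2
        ≤ (4 * condVariance μ g ε t ω + 2 * (K ^ 2 / t)) / t ^ 2 :=
          div_le_div_of_nonneg_right (condSecond_le_condVariance ht0.le ε hK) (sq_nonneg t)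
      _ = 4 * (condVariance μ g ε t ω / t ^ 2) + 2 * K ^ 2 * (1 / t ^ 3) := by field_simp
  refine (mul_le_mul_of_nonneg_left hle hM.le).trans_eq ?_
  rw [integral_add hV hcube, integral_const_mul, integral_const_mul, integral_Ioi_inv_cube hM]
  field_simp

end Conditional

section Equivalences

variable {Ω : Type*} [mΩ : MeasurableSpace Ω] {μ : Measure Ω} [IsProbabilityMeasure μ]
  {g : ℕ → Ω → ℝ} {ε : ℝ}

lemma tendsto_condTruncSecond_iff (hε : 0 < ε) :
    TendstoInMeasure μ (fun t : ℝ => condTruncSecond μ g ε t) atTop (fun _ => 0) ↔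
      TendstoInMeasure μ (fun t : ℝ => condTail μ g ε t) atTop (fun _ => 0) ∧
      TendstoInMeasure μ (fun t : ℝ => condSecond μ g ε t) atTop (fun _ => 0) := by
  have hsplit : ∀ᶠ t : ℝ in atTop, ∀ ω, condTruncSecond μ g ε t ω =
      condSecond μ g ε t ω + ε ^ 2 * condTail μ g ε t ω :=
    (eventually_ne_atTop 0).mono fun t ht => condTruncSecond_eq_add ht ε
  have hscale := tendstoInMeasure_zero_congr_mul (μ := μ) (l := atTop) (sq_pos_of_pos hε)
    (.of_forall fun (t : ℝ) ω => (rfl : ε ^ 2 * condTail μ g ε t ω = _))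
  refine ⟨fun h => ⟨hscale.1 ?_, ?_⟩, fun h => ?_⟩
  · refine tendstoInMeasure_zero_of_abs_le_mul h one_pos ?_
    filter_upwards [hsplit, eventually_ge_atTop 0] with t hR ht ω
    rw [one_mul, hR ω, abs_of_nonneg (mul_nonneg (sq_nonneg ε) (condTail_nonneg ht ω))]
    exact (le_add_of_nonneg_left (condSecond_nonneg ht ω)).trans (le_abs_self _)
  · refine tendstoInMeasure_zero_of_abs_le_mul h one_pos ?_
    filter_upwards [hsplit, eventually_ge_atTop 0] with t hR ht ω
    rw [one_mul, hR ω, abs_of_nonneg (condSecond_nonneg ht ω)]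
    exact (le_add_of_nonneg_right (mul_nonneg (sq_nonneg ε) (condTail_nonneg ht ω))).trans
      (le_abs_self _)
  · exact (tendstoInMeasure_zero_add h.2 (hscale.2 h.1)).congr'
      (hsplit.mono fun t ht => .of_forall fun ω => (ht ω).symm) .rfl

lemma tendsto_condVariance_iff (hg : ∀ n, Measurable (g n)) (ε : ℝ) :
    TendstoInMeasure μ (fun t : ℝ => condVariance μ g ε t) atTop (fun _ => 0) ↔
      TendstoInMeasure μ (fun t : ℝ => condSecond μ g ε t) atTop (fun _ => 0) := by
  refine ⟨fun h => ?_, fun h => tendstoInMeasure_zero_of_abs_le_mul h one_pos ?_⟩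
  · refine tendstoInMeasure_zero_of_abs_le_add_error h
      (tendstoInMeasure_tailLaw_lt_abs hg tendsto_sqrt_sqrt_atTop)
      (tendsto_sq_sqrt_sqrt_div.const_mul 2 |>.trans_eq (by rw [mul_zero]))
      (c := 1 / 4) (by norm_num) four_pos ?_
    filter_upwards [eventually_ge_atTop 0] with t ht ω hK
    rw [abs_of_nonneg (condSecond_nonneg ht ω), abs_of_nonneg (condVariance_nonneg ht ω)]
    exact condSecond_le_condVariance ht ε ((le_abs_self _).trans hK.le)
  · filter_upwards [eventually_ge_atTop 0] with t ht ω
    rw [one_mul, abs_of_nonneg (condSecond_nonneg ht ω), abs_of_nonneg (condVariance_nonneg ht ω)]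
    exact condVariance_le_condSecond ht ε ω

lemma tendsto_average_condTail_iff (hε : 0 < ε) :
    TendstoInMeasure μ (fun (M : ℝ) ω => 1 / M * ∫ t in Set.Ioc 0 M, condTail μ g ε t ω)
      atTop (fun _ => 0) ↔
    TendstoInMeasure μ (fun t : ℝ => condTruncSecond μ g ε t) atTop (fun _ => 0) :=
  tendstoInMeasure_zero_congr_mul (by positivity)
    ((eventually_gt_atTop 0).mono fun _ hM => average_condTail hε hM)

lemma tendsto_average_condSecond_iff (hε : 0 < ε) :
    TendstoInMeasure μ (fun (M : ℝ) ω => M * ∫ t in Set.Ioi M, condSecond μ g ε t ω / t ^ 2)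
      atTop (fun _ => 0) ↔
    TendstoInMeasure μ (fun t : ℝ => condTruncSecond μ g ε t) atTop (fun _ => 0) :=
  tendstoInMeasure_zero_congr_mul one_half_pos
    ((eventually_gt_atTop 0).mono fun _ hM => average_condSecond hε hM)

lemma tendsto_average_condVariance_iff (hg : ∀ n, Measurable (g n)) (hε : 0 < ε) :
    TendstoInMeasure μ (fun (M : ℝ) ω => M * ∫ t in Set.Ioi M, condVariance μ g ε t ω / t ^ 2)
      atTop (fun _ => 0) ↔
    TendstoInMeasure μ (fun (M : ℝ) ω => M * ∫ t in Set.Ioi M, condSecond μ g ε t ω / t ^ 2)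
      atTop (fun _ => 0) := by
  have hV0 {M : ℝ} (hM : 0 < M) (ω : Ω) :
      0 ≤ M * ∫ t in Set.Ioi M, condVariance μ g ε t ω / t ^ 2 :=
    mul_nonneg hM.le (setIntegral_nonneg measurableSet_Ioi fun t ht =>
      div_nonneg (condVariance_nonneg (hM.trans ht).le ω) (sq_nonneg t))
  have hS0 {M : ℝ} (hM : 0 < M) (ω : Ω) :
      0 ≤ M * ∫ t in Set.Ioi M, condSecond μ g ε t ω / t ^ 2 :=
    (hV0 hM ω).trans (average_condVariance_le hε hM ω)
  refine ⟨fun h => ?_, fun h => tendstoInMeasure_zero_of_abs_le_mul h one_pos ?_⟩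
  · refine tendstoInMeasure_zero_of_abs_le_add_error h
      (tendstoInMeasure_tailLaw_lt_abs hg tendsto_sqrt_sqrt_atTop) tendsto_sq_sqrt_sqrt_div
      (c := 1 / 4) (by norm_num) four_pos ?_
    filter_upwards [eventually_gt_atTop 0] with M hM ω hK
    rw [abs_of_nonneg (hS0 hM ω), abs_of_nonneg (hV0 hM ω)]
    exact average_condSecond_le hε hM ((le_abs_self _).trans hK.le)
  · filter_upwards [eventually_gt_atTop 0] with M hM ω
    rw [one_mul, abs_of_nonneg (hS0 hM ω), abs_of_nonneg (hV0 hM ω)]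
    exact average_condVariance_le hε hM ω

end Equivalences

/-! ### The weak law for exchangeable variables -/

section WeakLaw

variable {Ω : Type*} [mΩ : MeasurableSpace Ω] {μ : Measure Ω} [IsProbabilityMeasure μ]
  {g D : ℕ → Ω → ℝ}

lemma measurableSet_lt_abs_avg_sub {α : Type*} {_ : MeasurableSpace α} {X : ℕ → α → ℝ}
    (hX : ∀ n, Measurable (X n)) (N : ℕ) {d : α → ℝ} (hd : Measurable d) (ε : ℝ) :
    MeasurableSet {a | ε < |avg X N a - d a|} :=
  measurableSet_lt measurable_const ((measurable_avg hX N).sub hd).abs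

lemma Exchangeable.condExp_lt_abs_avg_sub_ae_eq (hg : ∀ n, Measurable (g n))
    (h : Exchangeable μ g) (N : ℕ) {d : Ω → ℝ} (hd : Measurable[tail g] d) (ε : ℝ) :
    μ⟦{ω | ε < |avg g N ω - d ω|} | tail g⟧ =ᵐ[μ] fun ω =>
      (Measure.infinitePi fun _ => tailLaw μ g ω).real
        {x : ℕ → ℝ | ε < |avg (fun n x => x n) N x - d ω|} := by
  let S : Set (Ω × (ℕ → ℝ)) := {p | ε < |avg (fun n x => x n) N p.2 - d p.1|}
  have hS : MeasurableSet[(tail g).prod inferInstance] S :=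
    @measurableSet_lt_abs_avg_sub _ ((tail g).prod inferInstance) (fun n (p : Ω × (ℕ → ℝ)) => p.2 n)
      (fun n => (measurable_pi_apply n).comp (@measurable_snd _ _ (tail g) _)) N
      (fun p => d p.1) (hd.comp (@measurable_fst _ _ (tail g) _)) ε
  have hint : Integrable ({ω | ε < |avg g N ω - d ω|}.indicator fun _ => (1 : ℝ)) μ :=
    (integrable_const _).indicator
      (measurableSet_lt_abs_avg_sub hg N (hd.mono (tail_le hg) le_rfl) ε)
  have hF : StronglyMeasurable[(tail g).prod inferInstance] (S.indicator fun _ => (1 : ℝ)) :=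
    (@stronglyMeasurable_const _ _ ((tail g).prod inferInstance) _ 1).indicator hS
  refine (h.condExp_tail_ae_eq hg hF hint).trans (.of_forall fun ω => ?_)
  exact integral_indicator_one (measurableSet_lt_abs_avg_sub (d := fun _ => d ω)
    (fun n => measurable_pi_apply n) N measurable_const ε)

theorem wlln_iff_condWLLN (hg : ∀ n, Measurable (g n)) : WLLN μ g D ↔ CondWLLN μ g D :=
  and_congr_right fun hD => forall₂_congr fun ε _ => (tendstoInMeasure_condExp_indicator_iff
    (tail_le hg) fun N => measurableSet_lt_abs_avg_sub hg N
      ((hD N).mono (tail_le hg) le_rfl) ε).symm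

lemma iIndepFun_eval (ν : Measure ℝ) [IsProbabilityMeasure ν] :
    iIndepFun (fun n (x : ℕ → ℝ) => x n) (Measure.infinitePi fun _ => ν) :=
  iIndepFun_infinitePi (X := fun _ x => x) fun _ => measurable_id

lemma Exchangeable.tendsto_condTruncSecond_of_condWLLN (hg : ∀ n, Measurable (g n))
    (hex : Exchangeable μ g) (h : CondWLLN μ g D) :
    TendstoInMeasure μ (fun N : ℕ => condTruncSecond μ g 1 N) atTop (fun _ => 0) := by
  have hK : Tendsto (fun N : ℕ => √√(N : ℝ)) atTop atTop :=
    tendsto_sqrt_sqrt_atTop.comp tendsto_natCast_atTop_atTop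
  have hKN : Tendsto (fun N : ℕ => √√(N : ℝ) ^ 2 / N) atTop (𝓝 0) :=
    tendsto_sq_sqrt_sqrt_div.comp tendsto_natCast_atTop_atTop
  refine tendstoInMeasure_zero_of_abs_lt fun δ hδ => ?_
  obtain ⟨η, hη, hη4, hηδ⟩ : ∃ η : ℝ, 0 < η ∧ η ≤ 1 / 6 ∧ 156 * (3 * η) ≤ δ / 2 :=
    ⟨min (1 / 6) (δ / 936), by positivity, min_le_left _ _, by
      linarith [min_le_right (1 / 6) (δ / 936)]⟩
  refine ⟨_, _, (h.2 η hη).congr_left fun N =>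
    hex.condExp_lt_abs_avg_sub_ae_eq hg N (h.1 N) η,
    tendstoInMeasure_tailLaw_lt_abs hg hK, η, hη, ?_⟩
  filter_upwards [eventually_gt_atTop 0,
    hKN.eventually_lt_const (by positivity : 0 < δ / 4)] with N hN hKN ω hG hH
  have hG' := (le_abs_self _).trans hG.le
  have hbound := cappedMoment_le_of_avg (d := D N ω) (fun n => measurable_pi_apply n)
    (iIndepFun_eval (tailLaw μ g ω)) (fun n => Measure.infinitePi_map_eval _ n) hN hη.le
    (by linarith) ((le_abs_self _).trans (hH.le.trans (by linarith)))
  rw [abs_of_nonneg (condTruncSecond_nonneg N.cast_nonneg ω), condTruncSecond_eq_cappedMoment,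
    one_mul]
  linarith

lemma measurable_condMean (ε t : ℝ) : Measurable[tail g] (condMean μ g ε t) :=
  (measurable_trunc _).stronglyMeasurable.integral_kernel.measurable

lemma Exchangeable.condWLLN_condMean (hg : ∀ n, Measurable (g n)) (hex : Exchangeable μ g)
    (h : TendstoInMeasure μ (fun N : ℕ => condTruncSecond μ g 1 N) atTop (fun _ => 0)) :
    CondWLLN μ g (fun N : ℕ => condMean μ g 1 N) := by
  refine ⟨fun N => measurable_condMean 1 N, fun ε hε => ?_⟩
  refine TendstoInMeasure.congr_left (fun N =>
    (hex.condExp_lt_abs_avg_sub_ae_eq hg N (measurable_condMean 1 N) ε).symm) ?_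
  refine tendstoInMeasure_zero_of_abs_le_mul h (by positivity : 0 < 1 + 1 / ε ^ 2) ?_
  filter_upwards [eventually_gt_atTop 0] with N hN ω
  have hbound := measureReal_avg_sub_le (fun n => measurable_pi_apply n)
    (iIndepFun_eval (tailLaw μ g ω)) (fun n => Measure.infinitePi_map_eval _ n) hN hε
  rw [abs_of_nonneg measureReal_nonneg, abs_of_nonneg (condTruncSecond_nonneg N.cast_nonneg ω),
    condTruncSecond_eq_cappedMoment]
  simpa only [condMean, one_mul] using hbound

lemma condTruncSecond_eq_mul {ε : ℝ} (hε : ε ≠ 0) (t : ℝ) (ω : Ω) :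
    condTruncSecond μ g ε t ω = ε * condTruncSecond μ g 1 (ε * t) ω := by
  rw [condTruncSecond_eq_cappedMoment, condTruncSecond_eq_cappedMoment, one_mul]
  field_simp

lemma condTruncSecond_le_ceil {s : ℝ} (hs : 1 ≤ s) (ω : Ω) :
    condTruncSecond μ g 1 s ω ≤ 2 * condTruncSecond μ g 1 ⌈s⌉₊ ω := by
  have hs0 : 0 < s := one_pos.trans_le hs
  have hN : (0 : ℝ) < ⌈s⌉₊ := hs0.trans_le (Nat.le_ceil s)
  simp only [condTruncSecond_eq_cappedMoment, one_mul]
  calc 1 / s * cappedMoment (tailLaw μ g ω) s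
      ≤ 1 / s * cappedMoment (tailLaw μ g ω) ⌈s⌉₊ := by
        gcongr
        exact cappedMoment_mono _ hs0.le (Nat.le_ceil s)
    _ ≤ 2 / ⌈s⌉₊ * cappedMoment (tailLaw μ g ω) ⌈s⌉₊ := by
        refine mul_le_mul_of_nonneg_right ?_ (cappedMoment_nonneg _ _)
        rw [div_le_div_iff₀ hs0 hN]
        linarith [Nat.ceil_lt_add_one hs0.le]
    _ = 2 * (1 / ⌈s⌉₊ * cappedMoment (tailLaw μ g ω) ⌈s⌉₊) := by ring

lemma tendsto_condTruncSecond_of_nat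
    (h : TendstoInMeasure μ (fun N : ℕ => condTruncSecond μ g 1 N) atTop (fun _ => 0))
    {ε : ℝ} (hε : 0 < ε) :
    TendstoInMeasure μ (fun t : ℝ => condTruncSecond μ g ε t) atTop (fun _ => 0) := by
  have hmul : Tendsto (fun t : ℝ => ε * t) atTop atTop := tendsto_id.const_mul_atTop hε
  have hreal : TendstoInMeasure μ (fun s : ℝ => condTruncSecond μ g 1 s) atTop (fun _ => 0) := by
    refine tendstoInMeasure_zero_of_abs_le_mul (h.comp tendsto_nat_ceil_atTop) two_pos ?_
    filter_upwards [eventually_ge_atTop 1] with s hs ω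
    rw [abs_of_nonneg (condTruncSecond_nonneg (zero_le_one.trans hs) ω)]
    exact (condTruncSecond_le_ceil hs ω).trans
      (mul_le_mul_of_nonneg_left (le_abs_self _) zero_le_two)
  exact (tendstoInMeasure_zero_congr_mul hε
    (.of_forall fun t ω => condTruncSecond_eq_mul hε.ne' t ω)).2 (hreal.comp hmul)

lemma WLLN.tendstoInMeasure (h : WLLN μ g D) :
    TendstoInMeasure μ (fun N ω => avg g N ω - D N ω) atTop (fun _ => 0) :=
  tendstoInMeasure_zero_iff.2 fun δ hδ => squeeze_zero (fun _ => measureReal_nonneg)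
    (fun _ => measureReal_mono fun _ hω => (half_lt_self hδ).trans_le hω)
    (h.2 (δ / 2) (half_pos hδ))

lemma tendsto_condMean_div_sqrt
    (h : TendstoInMeasure μ (fun N : ℕ => condTruncSecond μ g 1 N) atTop (fun _ => 0)) :
    TendstoInMeasure μ (fun (N : ℕ) ω => condMean μ g 1 N ω / √N) atTop (fun _ => 0) := by
  refine tendstoInMeasure_zero_of_abs_lt fun δ hδ => ⟨_, _, h, h, δ ^ 2, by positivity,
    .of_forall fun N ω hR _ => ?_⟩
  exact abs_lt_of_sq_lt_sq ((sq_condMean_div_sqrt_le N.cast_nonneg ω).trans_lt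
    ((le_abs_self _).trans_lt hR)) hδ.le

theorem tendsto_corrector_div_sqrt
    (h : TendstoInMeasure μ (fun N : ℕ => condTruncSecond μ g 1 N) atTop (fun _ => 0))
    (hD : WLLN μ g D) (hΔ : WLLN μ g fun N => condMean μ g 1 N) :
    TendstoInMeasure μ (fun (N : ℕ) ω => D N ω / √N) atTop (fun _ => 0) := by
  have hdiv {E : ℕ → Ω → ℝ} (hE : TendstoInMeasure μ E atTop (fun _ => 0)) :
      TendstoInMeasure μ (fun (N : ℕ) ω => E N ω / √N) atTop (fun _ => 0) := by
    refine tendstoInMeasure_zero_of_abs_le_mul hE one_pos ?_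
    filter_upwards [eventually_gt_atTop 0] with N hN ω
    rw [abs_div, abs_of_nonneg (Real.sqrt_nonneg _), one_mul]
    exact div_le_self (abs_nonneg _) (Real.one_le_sqrt.2 (by exact_mod_cast hN))
  have hneg : TendstoInMeasure μ (fun N ω => D N ω - avg g N ω) atTop (fun _ => 0) :=
    tendstoInMeasure_zero_of_abs_le_mul hD.tendstoInMeasure one_pos
      (.of_forall fun N ω => by rw [one_mul, abs_sub_comm])
  exact (tendstoInMeasure_zero_add (tendsto_condMean_div_sqrt h)
    (tendstoInMeasure_zero_add (hdiv hΔ.tendstoInMeasure) (hdiv hneg))).congr_left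
      fun N => .of_forall fun ω => by ring

end WeakLaw

end ExchWLLN

theorem theorem6p1 {Ω : Type*} [MeasurableSpace Ω] (μ : Measure Ω) [IsProbabilityMeasure μ]
    (g : ℕ → Ω → ℝ) (hg : ∀ n, Measurable (g n)) (hexch : ExchWLLN.Exchangeable μ g) :
    List.TFAE [
      -- (i)
      ∃ D : ℕ → Ω → ℝ, ExchWLLN.WLLN μ g D,
      -- (i)'
      ∃ D : ℕ → Ω → ℝ, ExchWLLN.CondWLLN μ g D,
      -- (ii)
      ∀ ε : ℝ, 0 < ε →
        TendstoInMeasure μ (fun t : ℝ => ExchWLLN.condTail μ g ε t) atTop (fun _ => (0 : ℝ)) ∧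
        TendstoInMeasure μ (fun t : ℝ => ExchWLLN.condSecond μ g ε t) atTop (fun _ => (0 : ℝ)),
      -- (ii)'
      ∀ ε : ℝ, 0 < ε →
        TendstoInMeasure μ (fun t : ℝ => ExchWLLN.condTail μ g ε t) atTop (fun _ => (0 : ℝ)) ∧
        TendstoInMeasure μ (fun t : ℝ => ExchWLLN.condVariance μ g ε t) atTop (fun _ => (0 : ℝ)),
      -- (ii)''
      ∀ ε : ℝ, 0 < ε →
        TendstoInMeasure μ (fun t : ℝ => ExchWLLN.condTruncSecond μ g ε t) atTop
          (fun _ => (0 : ℝ)),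
      -- (iii)
      ∀ ε : ℝ, 0 < ε →
        TendstoInMeasure μ
          (fun (M : ℝ) (ω : Ω) => (1 / M) * ∫ t in Set.Ioc 0 M, ExchWLLN.condTail μ g ε t ω)
          atTop (fun _ => (0 : ℝ)),
      -- (iii)'
      ∀ ε : ℝ, 0 < ε →
        TendstoInMeasure μ
          (fun (M : ℝ) (ω : Ω) => M * ∫ t in Set.Ioi M, ExchWLLN.condSecond μ g ε t ω / t ^ 2)
          atTop (fun _ => (0 : ℝ)),
      -- (iii)''
      ∀ ε : ℝ, 0 < ε →
        TendstoInMeasure μ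
          (fun (M : ℝ) (ω : Ω) => M * ∫ t in Set.Ioi M, ExchWLLN.condVariance μ g ε t ω / t ^ 2)
          atTop (fun _ => (0 : ℝ))] ∧
    -- under these conditions the truncated conditional means can serve as correctors
    ((∃ D : ℕ → Ω → ℝ, ExchWLLN.WLLN μ g D) →
      ExchWLLN.WLLN μ g (fun N : ℕ => ExchWLLN.condMean μ g 1 N) ∧
      ExchWLLN.CondWLLN μ g (fun N : ℕ => ExchWLLN.condMean μ g 1 N)) ∧
    -- all correctors are of smaller order than the square root of `N`
    (∀ D : ℕ → Ω → ℝ, ExchWLLN.WLLN μ g D ∨ ExchWLLN.CondWLLN μ g D →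
      TendstoInMeasure μ (fun (N : ℕ) (ω : Ω) => D N ω / √(N : ℝ)) atTop
        (fun _ => (0 : ℝ))) := by
  have hR {D : ℕ → Ω → ℝ} (hD : ExchWLLN.WLLN μ g D) :
      TendstoInMeasure μ (fun N : ℕ => ExchWLLN.condTruncSecond μ g 1 N) atTop (fun _ => (0 : ℝ)) :=
    hexch.tendsto_condTruncSecond_of_condWLLN hg ((ExchWLLN.wlln_iff_condWLLN hg).1 hD)
  have hcond {D : ℕ → Ω → ℝ} (hD : ExchWLLN.WLLN μ g D) :=
    hexch.condWLLN_condMean hg (hR hD)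
  refine ⟨?_, ?_, ?_⟩
  · tfae_have 1 ↔ 2 := exists_congr fun D => ExchWLLN.wlln_iff_condWLLN hg
    tfae_have 1 → 5 := fun ⟨_, hD⟩ _ hε => ExchWLLN.tendsto_condTruncSecond_of_nat (hR hD) hε
    tfae_have 5 → 2 := fun h =>
      ⟨_, hexch.condWLLN_condMean hg ((h 1 one_pos).comp tendsto_natCast_atTop_atTop)⟩
    tfae_have 5 ↔ 3 := forall₂_congr fun _ hε => ExchWLLN.tendsto_condTruncSecond_iff hε
    tfae_have 4 ↔ 3 := forall₂_congr fun ε _ => and_congr_right fun _ =>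
      ExchWLLN.tendsto_condVariance_iff hg ε
    tfae_have 6 ↔ 5 := forall₂_congr fun _ hε => ExchWLLN.tendsto_average_condTail_iff hε
    tfae_have 7 ↔ 5 := forall₂_congr fun _ hε => ExchWLLN.tendsto_average_condSecond_iff hε
    tfae_have 8 ↔ 7 := forall₂_congr fun _ hε => ExchWLLN.tendsto_average_condVariance_iff hg hε
    tfae_finish
  · rintro ⟨D, hD⟩
    exact ⟨(ExchWLLN.wlln_iff_condWLLN hg).2 (hcond hD), hcond hD⟩
  · intro D hD
    have hD' : ExchWLLN.WLLN μ g D := hD.elim id (ExchWLLN.wlln_iff_condWLLN hg).2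
    exact ExchWLLN.tendsto_corrector_div_sqrt (hR hD') hD'
      ((ExchWLLN.wlln_iff_condWLLN hg).2 (hcond hD'))
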